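/- For an integer $a\ge -1$ put $\Delta=a^2+3a+9$, and let $K=\mathbb{Q}(\rho)$ be the simplest cubic field generated by a root $\rho$ of $x^3-ax^2-(a+3)x-1$. Let $\mathcal{O}_K$ be its ring of integers and $\delta=[\mathcal{O}_K:\mathbb{Z}[\rho]]$. For a prime $p$ and integers $k,l$ write $$B_p(k,l)=\Big\{1,\rho,\frac{k+l\rho+\rho^2}{p}\Big\}.$$ 1. $\delta=3$ if and only if $B_3(1,1)$ is an integral basis of $K$. This happens exactly when either $a\equiv 3$ or $21\pmod{27}$, $a>12$ and $\Delta/27$ is square-free, or $a=3$. 2. Let $p>3$ be a prime. Then $\delta=p$ if and only if $B_p(k,l)$ is an integral basis of $K$ for some integers $1\le k,l\le p-1$. There is a simplest cubic field with $\delta=p$ if and only if $p\equiv 1\pmod 6$. In that case there are two distinct residue classes $a_1,a_2$ modulo $p^2$ such that the residue classes modulo $p^2$ of the parameters $a\ge -1$ with $\delta=p$ are exactly $a_1$ and $a_2$ (both occur). Moreover, for each $i\in\{1,2\}$ there is a unique pair $(k_i,l_i)$ of residue classes modulo $p$ such that, for every simplest cubic field with $a\equiv a_i\pmod{p^2}$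 and all integers $k,l$ for which $B_p(k,l)$ is an integral basis of $K$, one has $k\equiv k_i$ and $l\equiv l_i\pmod p$. -/

import Mathlib

open Polynomial NumberField
open scoped IntermediateField

universe u

/-- The cubic polynomial `x³ - a x² - (a + 3) x - 1`. -/
noncomputable def simplestCubicPoly (a : ℤ) : ℤ[X] :=
  X ^ 3 - C a * X ^ 2 - C (a + 3) * X - 1

/-- `K` is the simplest cubic field with parameter `a ≥ -1` and generator `ρ`: `K = ℚ(ρ)` and `ρ` is
a root of `x³ - a x² - (a + 3) x - 1`. -/
structure IsSimplestCubicField (K : Type u) [Field K] [NumberField K] (a : ℤ) (ρ : K) : Prop where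
  neg_one_le : -1 ≤ a
  aeval_eq_zero : aeval ρ (simplestCubicPoly a) = 0
  adjoin_eq_top : ℚ⟮ρ⟯ = ⊤

/-- The integer `Δ = a² + 3a + 9`. -/
def simplestCubicDelta (a : ℤ) : ℤ := a ^ 2 + 3 * a + 9

/-- The index `[𝓞 K : ℤ[ρ]]` of additive groups, where `ℤ[ρ]`, a subring of `K`, is regarded as a
subgroup of `𝓞 K` (it is contained in `𝓞 K` when `ρ` is an algebraic integer). -/
noncomputable def moduleIndex {K : Type u} [Field K] [NumberField K] (ρ : K) : ℕ :=
  ((Algebra.adjoin ℤ {ρ}).toSubring.toAddSubgroup.comap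
    (algebraMap (𝓞 K) K).toAddMonoidHom).index

/-- The family `b` of elements of `K` is an integral basis of `K`, that is, it lies in `𝓞 K` and is a
`ℤ`-basis of it. -/
def IsIntegralBasis {K : Type u} [Field K] [NumberField K] {ι : Type*} (b : ι → K) : Prop :=
  ∃ B : Module.Basis ι ℤ (𝓞 K), ∀ i, (B i : K) = b i

/-- The family `B_p(k, l) = {1, ρ, (k + l ρ + ρ²) / p}`. -/
noncomputable def basisB {K : Type u} [Field K] [NumberField K] (ρ : K) (p : ℕ) (k l : ℤ) :
    Fin 3 → K :=
  ![1, ρ, ((k : K) + (l : K) * ρ + ρ ^ 2) / (p : K)]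

/-!
Put `y = 3ρ - a`. Then `y³ = 3Δy + Δ(2a + 3)`, while `4Δ = (2a + 3)² + 27`, so a prime `q ≠ 3`
dividing `Δ` does not divide `2a + 3`. The index `δ = [𝓞 K : ℤ[ρ]]` is determined one prime at a
time.

* Only primes dividing `Δ` can divide `δ`, since `Δ³ 𝓞 K ⊆ ℤ[ρ]` (`delta_pow_smul_mem`).
* If `q ≠ 3` divides `Δ` exactly once, the polynomial of `y` is Eisenstein at `q`, so `q ∤ δ`
  (`mem_adjoin_of_prime_smul`). At `3`, the polynomial of `ρ - 1` is Eisenstein when `3 ∣ a` and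
  `a ≢ 3 (mod 9)` (`mem_adjoin_of_three_smul`).
* Let `q ≠ 3`. If `q² ∣ Δ`, then `y² / q` is integral, and if `q³ ∣ Δ` even `y² / q²` is. If
  `q² ∥ Δ`, the polynomial of `y² / q` is Eisenstein at `q`, so that adjoining this element to
  `ℤ[ρ]` already gives an order whose index is prime to `q`. For `a ≡ 3 (mod 9)` the element
  `(ρ - a / 3)² / 3` plays this role at `3`, except that for `a ≡ 12 (mod 27)` already
  `(ρ - a / 3) / 3` is integral.

Hence `δ = p > 3` means that `p² ∥ Δ`, that no other prime except possibly `3` divides `Δ` twice,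
and that `a ≢ 3 (mod 9)` (`moduleIndex_eq_prime_iff`); similarly for `δ = 3`
(`moduleIndex_eq_three_iff`). In these cases `y² / p`, respectively `(ρ - a / 3)² / 3`, yields an
integral basis `B_p(k, l)`, with `9k ≡ a²` and `9l ≡ -6a` modulo `p` if `p > 3`. Conversely, if
`B_p(k, l)` is an integral basis, then `ℤ[ρ]` is the kernel of its last coordinate modulo `p`, so
that `δ = p`.

The roots of `Δ` modulo `p²` are `3u` with `u` a primitive cube root of unity; they exist if and
only if `p ≡ 1 (mod 6)`, and there are then two of them, exchanged by `a ↦ -3 - a`. That each root class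
contains some `a` with `δ = p` requires a value of `Δ` in an arithmetic progression that is not
divisible by `p³` nor by `q²` for any other prime `q ≠ 3`. It is supplied by an elementary sieve
(`exists_simplestCubicDelta_progression`) based on Chebyshev's bound for the number of primes.
-/

/-! ### Saturation and orders generated by a root of a cubic -/

theorem AddSubgroup.mem_of_isCoprime_zsmul_mem {A : Type*} [AddCommGroup A] (S : AddSubgroup A)
    {m n : ℤ} (h : IsCoprime m n) {z : A} (hm : m • z ∈ S) (hn : n • z ∈ S) : z ∈ S := by
  obtain ⟨u, v, huv⟩ := h
  have : z = u • (m • z) + v • (n • z) := by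
    rw [smul_smul, smul_smul, ← add_smul, huv, one_smul]
  rw [this]
  exact S.add_mem (S.zsmul_mem hm u) (S.zsmul_mem hn v)

/-- Saturation at every prime suffices: if `q z ∈ S` implies `z ∈ S` for all primes `q` and all `z`
in a subgroup `T`, then `n z ∈ S` implies `z ∈ S` for all `n ≠ 0` and all `z ∈ T`. -/
theorem AddSubgroup.mem_of_saturated_prime {A : Type*} [AddCommGroup A] (S T : AddSubgroup A)
    (h : ∀ q : ℕ, q.Prime → ∀ z ∈ T, (q : ℤ) • z ∈ S → z ∈ S) {n : ℕ} (hn : n ≠ 0) :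
    ∀ z ∈ T, (n : ℤ) • z ∈ S → z ∈ S := by
  induction n using Nat.recOnMul with
  | zero => exact absurd rfl hn
  | one => intro z _ hz; simpa using hz
  | prime p hp => exact h p hp
  | mul m k hm hk =>
    intro z hzT hz
    have hm0 : m ≠ 0 := fun h0 => hn (by simp [h0])
    have hk0 : k ≠ 0 := fun h0 => hn (by simp [h0])
    refine hk hk0 z hzT (hm hm0 _ (T.zsmul_mem hzT _) ?_)
    rw [smul_smul]
    exact_mod_cast hz

section Cubic

variable {K : Type u} [Field K]

theorem mem_adjoin_int_of_cubic {w : K} {b c d : ℤ} (hw : w ^ 3 = b * w ^ 2 + c * w + d) {z : K} :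
    z ∈ Algebra.adjoin ℤ {w} ↔ ∃ i j k : ℤ, z = i + j * w + k * w ^ 2 := by
  constructor
  · intro hz
    induction hz using Algebra.adjoin_induction with
    | mem x hx => exact ⟨0, 1, 0, by simp [Set.mem_singleton_iff.1 hx]⟩
    | algebraMap r => exact ⟨r, 0, 0, by simp⟩
    | add x y _ _ hx hy =>
      obtain ⟨i, j, k, rfl⟩ := hx
      obtain ⟨i', j', k', rfl⟩ := hy
      exact ⟨i + i', j + j', k + k', by push_cast; ring⟩
    | mul x y _ _ hx hy =>
      obtain ⟨i, j, k, rfl⟩ := hx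
      obtain ⟨i', j', k', rfl⟩ := hy
      -- reduce the product with `w³ = b w² + c w + d` and
      -- `w⁴ = (b² + c) w² + (b c + d) w + b d`
      refine ⟨i * i' + (j * k' + k * j') * d + k * k' * (b * d),
        i * j' + j * i' + (j * k' + k * j') * c + k * k' * (b * c + d),
        i * k' + j * j' + k * i' + (j * k' + k * j') * b + k * k' * (b ^ 2 + c), ?_⟩
      push_cast
      linear_combination (j * k' + k * j' + k * k' * (w + b)) * hw
  · rintro ⟨i, j, k, rfl⟩
    have hw : w ∈ Algebra.adjoin ℤ {w} := Algebra.subset_adjoin rfl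
    exact add_mem (add_mem (intCast_mem _ i) (mul_mem (intCast_mem _ j) hw))
      (mul_mem (intCast_mem _ k) (pow_mem hw 2))

theorem isIntegral_of_cubic {w : K} {b c d : ℤ} (hw : w ^ 3 = b * w ^ 2 + c * w + d) :
    IsIntegral ℤ w := by
  refine ⟨X ^ 3 - C b * X ^ 2 - C c * X - C d, ?_, ?_⟩
  · monicity!
  · change aeval w _ = 0
    simp only [map_sub, map_mul, map_pow, aeval_X, eq_intCast, map_intCast, hw]
    ring

theorem aeval_intCubic_eq_zero {w : K} {b c d : ℤ} (hw : w ^ 3 = b * w ^ 2 + c * w + d) :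
    aeval w (X ^ 3 - C b * X ^ 2 - C c * X - C d : ℤ[X]) = 0 := by
  simp only [map_sub, map_mul, map_pow, aeval_X, eq_intCast, map_intCast, hw]
  ring

variable [NumberField K]

/-- A root of an irreducible monic integral polynomial whose degree is `[K : ℚ]` is the generator of
a power basis of `K`. -/
theorem exists_powerBasis_of_irreducible {w : K} {f : ℤ[X]} (hmon : f.Monic) (hirr : Irreducible f)
    (hdeg : f.natDegree = Module.finrank ℚ K) (hroot : aeval w f = 0) :
    ∃ B : PowerBasis ℚ K, B.gen = w ∧ minpoly ℤ w = f := by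
  have hint : IsIntegral ℤ w := ⟨f, hmon, hroot⟩
  have hQ : minpoly ℚ w = f.map (Int.castRingHom ℚ) := by
    refine (minpoly.eq_of_irreducible_of_monic
      ((hmon.irreducible_iff_irreducible_map_fraction_map (K := ℚ)).1 hirr) ?_
      (hmon.map _)).symm
    rw [aeval_map_algebraMap, hroot]
  have hZ : minpoly ℤ w = f := by
    refine Polynomial.map_injective (Int.castRingHom ℚ) Int.cast_injective ?_
    rw [← hQ]
    exact (minpoly.isIntegrallyClosed_eq_field_fractions' ℚ hint).symm
  have hnat : (minpoly ℚ w).natDegree = f.natDegree := by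
    rw [hQ, hmon.natDegree_map]
  have htop : ℚ⟮w⟯ = ⊤ :=
    (Field.primitive_element_iff_minpoly_natDegree_eq ℚ w).2 (hnat.trans hdeg)
  have htop' : Algebra.adjoin ℚ {w} = ⊤ := by
    rw [← IntermediateField.adjoin_simple_toSubalgebra_of_isAlgebraic
      (hint.tower_top (A := ℚ)).isAlgebraic, htop, IntermediateField.top_toSubalgebra]
  exact ⟨PowerBasis.ofAdjoinEqTop hint.tower_top htop', by simp, hZ⟩

/-- A root of an Eisenstein cubic at `q` in a cubic field `K` generates an order of index prime
to `q` in the ring of integers. -/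
theorem exists_isCoprime_smul_mem_adjoin_of_eisenstein (hK : Module.finrank ℚ K = 3) {w : K}
    {b c d : ℤ} (hw : w ^ 3 = b * w ^ 2 + c * w + d) {q : ℕ} (hq : q.Prime)
    (hb : (q : ℤ) ∣ b) (hc : (q : ℤ) ∣ c) (hd : (q : ℤ) ∣ d) (hd2 : ¬ (q : ℤ) ^ 2 ∣ d)
    {z : K} (hz : IsIntegral ℤ z) {m : ℤ} (hm : m ≠ 0) (hmz : m • z ∈ Algebra.adjoin ℤ {w}) :
    ∃ m' : ℤ, IsCoprime m' q ∧ m' • z ∈ Algebra.adjoin ℤ {w} := by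
  have hqZ : Prime (q : ℤ) := Nat.prime_iff_prime_int.1 hq
  set f : ℤ[X] := X ^ 3 - C b * X ^ 2 - C c * X - C d with hf
  have hdeg : f.natDegree = 3 := by rw [hf]; compute_degree!
  have hmon : f.Monic := by rw [hf]; monicity!
  have hcoeff : ∀ n < 3, f.coeff n = if n = 0 then -d else if n = 1 then -c else -b := by
    intro n hn
    interval_cases n <;>
      simp [hf, coeff_X, coeff_X_pow, -eq_intCast, -map_intCast, coeff_C]
  have hei : f.IsEisensteinAt (Submodule.span ℤ {(q : ℤ)}) := by
    refine ⟨?_, ?_, ?_⟩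
    · rw [hmon.leadingCoeff]
      intro h1
      exact hqZ.not_isUnit (isUnit_of_dvd_one (Ideal.mem_span_singleton.1 h1))
    · intro n hn
      rw [hdeg] at hn
      refine Ideal.mem_span_singleton.2 ?_
      rw [hcoeff n hn]
      split_ifs <;> simpa
    · rw [hcoeff 0 (by norm_num)]
      intro h
      have := Ideal.span_singleton_pow (q : ℤ) 2 ▸ h
      rw [Ideal.mem_span_singleton] at this
      exact hd2 (by simpa using this)
  have hirr : Irreducible f := hei.irreducible
    ((Ideal.span_singleton_prime hqZ.ne_zero).2 hqZ) hmon.isPrimitive (by omega)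
  obtain ⟨B, rfl, hmin⟩ := exists_powerBasis_of_irreducible hmon hirr (hdeg.trans hK.symm)
    (aeval_intCubic_eq_zero hw)
  have hfin : FiniteMultiplicity (q : ℤ) m :=
    Int.finiteMultiplicity_iff.2 ⟨by simpa using hq.ne_one, hm⟩
  obtain ⟨m', hmm, hm'⟩ := hfin.exists_eq_pow_mul_and_not_dvd
  refine ⟨m', ((Nat.prime_iff_prime_int.1 hq).coprime_iff_not_dvd.2 hm').symm, ?_⟩
  refine mem_adjoin_of_smul_prime_pow_smul_of_minpoly_isEisensteinAt (K := ℚ)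
    (n := multiplicity (q : ℤ) m) hqZ
    (isIntegral_of_cubic hw) (hz.smul m') ?_ (hmin ▸ hei)
  rwa [smul_smul, ← hmm]

end Cubic

/-! ### The simplest cubic polynomial and the field it defines -/

theorem simplestCubicPoly_monic (a : ℤ) : (simplestCubicPoly a).Monic := by
  unfold simplestCubicPoly; monicity!

theorem simplestCubicPoly_natDegree (a : ℤ) : (simplestCubicPoly a).natDegree = 3 := by
  unfold simplestCubicPoly; compute_degree!

theorem simplestCubicPoly_irreducible (a : ℤ) : Irreducible (simplestCubicPoly a) := by
  have hmon := simplestCubicPoly_monic a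
  rw [hmon.irreducible_iff_roots_eq_zero_of_degree_le_three
    (by rw [simplestCubicPoly_natDegree]; norm_num) (by rw [simplestCubicPoly_natDegree]),
    Multiset.eq_zero_iff_forall_notMem]
  intro r hr
  have h : r ^ 3 - a * r ^ 2 - (a + 3) * r - 1 = 0 := by
    have := (mem_roots'.1 hr).2
    simpa [simplestCubicPoly, IsRoot] using this
  have hu : r * (r ^ 2 - a * r - (a + 3)) = 1 := by linear_combination h
  rcases Int.isUnit_iff.1 (IsUnit.of_mul_eq_one _ hu) with rfl | rfl
  · omega
  · omega

theorem simplestCubicDelta_pos (a : ℤ) : 0 < simplestCubicDelta a := by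
  unfold simplestCubicDelta; nlinarith [sq_nonneg (2 * a + 3)]

theorem minpoly_rat_of_aeval_simplestCubicPoly {K : Type*} [Field K] [CharZero K] {a : ℤ} {ρ : K}
    (h : aeval ρ (simplestCubicPoly a) = 0) :
    minpoly ℚ ρ = (simplestCubicPoly a).map (Int.castRingHom ℚ) := by
  have hmon := simplestCubicPoly_monic a
  refine (minpoly.eq_of_irreducible_of_monic
    ((hmon.irreducible_iff_irreducible_map_fraction_map (K := ℚ)).1
      (simplestCubicPoly_irreducible a)) ?_ (hmon.map _)).symm
  rw [aeval_map_algebraMap, h]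

namespace IsSimplestCubicField

variable {K : Type u} [Field K] [NumberField K] {a : ℤ} {ρ : K}

theorem pow_three (h : IsSimplestCubicField K a ρ) :
    ρ ^ 3 = (a : ℤ) * ρ ^ 2 + (a + 3 : ℤ) * ρ + (1 : ℤ) := by
  have := h.aeval_eq_zero
  simp only [simplestCubicPoly, map_sub, map_mul, map_pow, aeval_X, eq_intCast, map_intCast,
    map_one] at this
  push_cast at this ⊢
  linear_combination this

theorem mem_adjoin_iff (h : IsSimplestCubicField K a ρ) {z : K} :
    z ∈ Algebra.adjoin ℤ {ρ} ↔ ∃ i j k : ℤ, z = i + j * ρ + k * ρ ^ 2 :=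
  mem_adjoin_int_of_cubic h.pow_three

theorem isIntegral (h : IsSimplestCubicField K a ρ) : IsIntegral ℤ ρ :=
  isIntegral_of_cubic h.pow_three

theorem minpoly_rat (h : IsSimplestCubicField K a ρ) :
    minpoly ℚ ρ = (simplestCubicPoly a).map (Int.castRingHom ℚ) :=
  minpoly_rat_of_aeval_simplestCubicPoly h.aeval_eq_zero

theorem natDegree_minpoly_rat (h : IsSimplestCubicField K a ρ) : (minpoly ℚ ρ).natDegree = 3 := by
  rw [h.minpoly_rat, (simplestCubicPoly_monic a).natDegree_map, simplestCubicPoly_natDegree]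

theorem finrank_eq (h : IsSimplestCubicField K a ρ) : Module.finrank ℚ K = 3 := by
  rw [← (Field.primitive_element_iff_minpoly_natDegree_eq ℚ ρ).1 h.adjoin_eq_top,
    h.natDegree_minpoly_rat]

/-- Linear independence of `1, ρ, ρ²` over `ℤ`. -/
theorem eq_zero_of_combination (h : IsSimplestCubicField K a ρ) {i j k : ℤ}
    (hz : (i : K) + j * ρ + k * ρ ^ 2 = 0) : i = 0 ∧ j = 0 ∧ k = 0 := by
  have hP : aeval ρ (C (i : ℚ) + C (j : ℚ) * X + C (k : ℚ) * X ^ 2) = 0 := by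
    simpa using hz
  have h0 : C (i : ℚ) + C (j : ℚ) * X + C (k : ℚ) * X ^ 2 = 0 := by
    by_contra hne
    have h1 := natDegree_le_of_dvd (minpoly.dvd ℚ ρ hP) hne
    rw [h.natDegree_minpoly_rat] at h1
    have h2 : (C (i : ℚ) + C (j : ℚ) * X + C (k : ℚ) * X ^ 2).natDegree ≤ 2 := by compute_degree
    omega
  have hc : ∀ n, (C (i : ℚ) + C (j : ℚ) * X + C (k : ℚ) * X ^ 2).coeff n = 0 :=
    fun n => by rw [h0, coeff_zero]
  refine ⟨?_, ?_, ?_⟩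
  · have := hc 0; simpa [coeff_X, coeff_X_pow, -eq_intCast, -map_intCast, coeff_C] using this
  · have := hc 1; simpa [coeff_X, coeff_X_pow, -eq_intCast, -map_intCast, coeff_C] using this
  · have := hc 2; simpa [coeff_X, coeff_X_pow, -eq_intCast, -map_intCast, coeff_C] using this

/-- `Δ³ 𝓞 ⊆ ℤ[ρ]`: the discriminant of `ℤ[ρ]` is `± N(f'(ρ))`, and
`f'(ρ) (2ρ² - (2a+1)ρ - (a+4)) = Δ`. -/
theorem delta_pow_smul_mem (h : IsSimplestCubicField K a ρ) {z : K} (hz : IsIntegral ℤ z) :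
    (simplestCubicDelta a ^ 3) • z ∈ Algebra.adjoin ℤ {ρ} := by
  obtain ⟨B, rfl, -⟩ := exists_powerBasis_of_irreducible (simplestCubicPoly_monic a)
    (simplestCubicPoly_irreducible a) ((simplestCubicPoly_natDegree a).trans h.finrank_eq.symm)
    h.aeval_eq_zero
  set ρ := B.gen
  have hmem := Algebra.discr_mul_isIntegral_mem_adjoin ℚ h.isIntegral hz
  set g : K := 2 * ρ ^ 2 - (2 * a + 1 : ℤ) * ρ - (a + 4 : ℤ) with hg
  have hgint : IsIntegral ℤ g := by
    have : g ∈ Algebra.adjoin ℤ {ρ} :=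
      h.mem_adjoin_iff.2 ⟨-(a + 4), -(2 * a + 1), 2, by rw [hg]; push_cast; ring⟩
    exact adjoin_le_integralClosure h.isIntegral this
  obtain ⟨n, hn⟩ := IsIntegrallyClosed.isIntegral_iff.1 (Algebra.isIntegral_norm ℚ hgint)
  have hder : aeval ρ (derivative (minpoly ℚ ρ)) * g = (simplestCubicDelta a : ℤ) := by
    have h3 := h.pow_three
    rw [h.minpoly_rat]
    simp only [simplestCubicPoly, simplestCubicDelta, hg]
    have e3 : aeval ρ (3 : ℚ[X]) = 3 := map_ofNat _ 3
    simp [e3]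
    push_cast at h3
    linear_combination (6 * ρ - 4 * a - 3) * h3
  rw [Algebra.discr_powerBasis_eq_norm] at hmem
  have hnorm := congrArg (Algebra.norm ℚ) hder
  rw [map_mul, ← hn, ← map_intCast (algebraMap ℚ K), Algebra.norm_algebraMap, h.finrank_eq]
    at hnorm
  rw [eq_intCast] at hnorm
  set N := Algebra.norm ℚ (aeval ρ (derivative (minpoly ℚ ρ)))
  have := Subalgebra.smul_mem _ hmem (n : ℤ)
  rw [h.finrank_eq] at this
  have := neg_mem this
  convert this using 1
  rw [zsmul_eq_mul, zsmul_eq_mul, Algebra.smul_def]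
  have hnorm' := congrArg (algebraMap ℚ K) hnorm
  push_cast
  simp only [map_mul, map_pow, map_intCast] at hnorm' ⊢
  rw [← hnorm']
  norm_num
  ring

end IsSimplestCubicField

/-! ### Primes not dividing the index -/

theorem natPrime_sq_dvd_of_sq_dvd_mul {q : ℕ} (hq : q.Prime) {m n : ℤ} (hn : ¬ (q : ℤ) ∣ n)
    (h : (q : ℤ) ^ 2 ∣ m * n) : (q : ℤ) ^ 2 ∣ m :=
  (((Nat.prime_iff_prime_int.1 hq).coprime_iff_not_dvd.2 hn).pow_left).dvd_of_dvd_mul_right h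

theorem Nat.Prime.not_dvd_two_mul_add_three {q : ℕ} (hq : q.Prime) (hq3 : q ≠ 3) {a : ℤ}
    (h : (q : ℤ) ∣ simplestCubicDelta a) : ¬ (q : ℤ) ∣ 2 * a + 3 := by
  intro h'
  have h27 : (q : ℤ) ∣ (3 : ℕ) ^ 3 := by
    have e : ((3 : ℕ) : ℤ) ^ 3 = 4 * simplestCubicDelta a - (2 * a + 3) * (2 * a + 3) := by
      unfold simplestCubicDelta; push_cast; ring
    rw [e]
    exact Int.dvd_sub (h.mul_left _) (h'.mul_left _)
  have := (Nat.prime_iff_prime_int.1 hq).dvd_of_dvd_pow h27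
  exact hq3 ((Nat.prime_dvd_prime_iff_eq hq Nat.prime_three).1 (by exact_mod_cast this))

theorem Nat.Prime.isCoprime_int_nine {q : ℕ} (hq : q.Prime) (hq3 : q ≠ 3) :
    IsCoprime (9 : ℤ) q := by
  have : Nat.Coprime (3 ^ 2) q := Nat.Coprime.pow_left 2
    ((Nat.coprime_primes Nat.prime_three hq).2 (Ne.symm hq3))
  exact_mod_cast Nat.isCoprime_iff_coprime.2 this

theorem three_dvd_of_three_dvd_simplestCubicDelta {a : ℤ} (h : 3 ∣ simplestCubicDelta a) :
    3 ∣ a := by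
  have e : a ^ 2 = simplestCubicDelta a - 3 * (a + 3) := by unfold simplestCubicDelta; ring
  exact Int.prime_three.dvd_of_dvd_pow (e ▸ dvd_sub h (dvd_mul_right _ _))

theorem Subalgebra.mem_of_isCoprime_zsmul_mem {A : Type*} [Ring A] (S : Subalgebra ℤ A) {m n : ℤ}
    (hmn : IsCoprime m n) {z : A} (hm : m • z ∈ S) (hn : n • z ∈ S) : z ∈ S :=
  AddSubgroup.mem_of_isCoprime_zsmul_mem S.toSubring.toAddSubgroup hmn hm hn

namespace IsSimplestCubicField

variable {K : Type u} [Field K] [NumberField K] {a : ℤ} {ρ : K}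

/-- The Tschirnhausen transform `3ρ - a` has no quadratic term in its minimal polynomial. -/
theorem three_mul_sub_pow_three (h : IsSimplestCubicField K a ρ) :
    (3 * ρ - a) ^ 3 = 3 * (simplestCubicDelta a : ℤ) * (3 * ρ - a)
      + (simplestCubicDelta a : ℤ) * (2 * a + 3) := by
  have h3 := h.pow_three
  unfold simplestCubicDelta
  push_cast at h3 ⊢
  linear_combination 27 * h3

/-- The index of `ℤ[ρ]` is prime to `q` if `q ≠ 3` and `q² ∤ Δ`. -/
theorem mem_adjoin_of_prime_smul (h : IsSimplestCubicField K a ρ) {q : ℕ} (hq : q.Prime)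
    (hq3 : q ≠ 3) (hΔ : ¬ (q : ℤ) ^ 2 ∣ simplestCubicDelta a) {z : K} (hz : IsIntegral ℤ z)
    (hqz : (q : ℤ) • z ∈ Algebra.adjoin ℤ {ρ}) : z ∈ Algebra.adjoin ℤ {ρ} := by
  by_cases hd : (q : ℤ) ∣ simplestCubicDelta a
  · -- `3ρ - a` is a root of an Eisenstein polynomial at `q`, and `9 ℤ[ρ] ⊆ ℤ[3ρ - a]`
    have hy := h.three_mul_sub_pow_three
    set y : K := 3 * ρ - a with hydef
    have hy3 : y ^ 3 = (0 : ℤ) * y ^ 2 + (3 * simplestCubicDelta a : ℤ) * y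
        + (simplestCubicDelta a * (2 * a + 3) : ℤ) := by
      push_cast; linear_combination hy
    have hmem : (9 * q : ℤ) • z ∈ Algebra.adjoin ℤ {y} := by
      obtain ⟨i, j, k, e⟩ := h.mem_adjoin_iff.1 hqz
      refine (mem_adjoin_int_of_cubic hy3).2
        ⟨9 * i + 3 * j * a + k * a ^ 2, 3 * j + 2 * k * a, k, ?_⟩
      rw [mul_smul, e, hydef]
      simp only [zsmul_eq_mul]
      push_cast
      ring
    obtain ⟨m', hm', hmz⟩ := exists_isCoprime_smul_mem_adjoin_of_eisenstein h.finrank_eq hy3 hq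
      (dvd_zero _) (hd.mul_left _) (hd.mul_right _)
      (fun h' => hΔ (natPrime_sq_dvd_of_sq_dvd_mul hq (hq.not_dvd_two_mul_add_three hq3 hd) h'))
      hz (mul_ne_zero (by norm_num) (by exact_mod_cast hq.ne_zero)) hmem
    refine Subalgebra.mem_of_isCoprime_zsmul_mem _ hm' ?_ hqz
    refine Algebra.adjoin_le (Set.singleton_subset_iff.2 ?_) hmz
    exact h.mem_adjoin_iff.2 ⟨-a, 3, 0, by rw [hydef]; push_cast; ring⟩
  · exact Subalgebra.mem_of_isCoprime_zsmul_mem _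
      ((((Nat.prime_iff_prime_int.1 hq).coprime_iff_not_dvd.2 hd).symm).pow_left (m := 3))
      (h.delta_pow_smul_mem hz) hqz

/-- The index of `ℤ[ρ]` is prime to `3` if `a ≢ 3 (mod 9)`. -/
theorem mem_adjoin_of_three_smul (h : IsSimplestCubicField K a ρ) (ha : a % 9 ≠ 3) {z : K}
    (hz : IsIntegral ℤ z) (hqz : (3 : ℤ) • z ∈ Algebra.adjoin ℤ {ρ}) :
    z ∈ Algebra.adjoin ℤ {ρ} := by
  by_cases hd : (3 : ℤ) ∣ simplestCubicDelta a
  · -- `ρ - 1` is a root of an Eisenstein polynomial at `3`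
    have ha3 := three_dvd_of_three_dvd_simplestCubicDelta hd
    have hx3 : (ρ - 1) ^ 3 = (a - 3 : ℤ) * (ρ - 1) ^ 2 + (3 * a : ℤ) * (ρ - 1)
        + (2 * a + 3 : ℤ) := by
      have h3 := h.pow_three
      push_cast at h3 ⊢
      linear_combination h3
    have hmem : (3 : ℤ) • z ∈ Algebra.adjoin ℤ {ρ - 1} := by
      obtain ⟨i, j, k, e⟩ := h.mem_adjoin_iff.1 hqz
      refine (mem_adjoin_int_of_cubic hx3).2 ⟨i + j + k, j + 2 * k, k, ?_⟩
      rw [e]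
      push_cast
      ring
    obtain ⟨m', hm', hmz⟩ := exists_isCoprime_smul_mem_adjoin_of_eisenstein h.finrank_eq hx3
      Nat.prime_three (by push_cast; omega) (by push_cast; omega) (by push_cast; omega)
      (by push_cast; omega) hz three_ne_zero hmem
    refine Subalgebra.mem_of_isCoprime_zsmul_mem _ hm' ?_ hqz
    refine Algebra.adjoin_le (Set.singleton_subset_iff.2 ?_) hmz
    exact h.mem_adjoin_iff.2 ⟨-1, 1, 0, by push_cast; ring⟩
  · exact Subalgebra.mem_of_isCoprime_zsmul_mem _
      (((Int.prime_three.coprime_iff_not_dvd.2 hd).symm).pow_left (m := 3))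
      (h.delta_pow_smul_mem hz) hqz

/-! ### Integral bases of the form `{1, ρ, (k + lρ + ρ²)/p}` -/

theorem mem_span_basisB_iff {p : ℕ} {k l : ℤ} {z : K} :
    z ∈ Submodule.span ℤ (Set.range (basisB ρ p k l)) ↔
      ∃ i j n : ℤ, z = i + j * ρ + n * ((k + l * ρ + ρ ^ 2) / p) := by
  rw [Submodule.mem_span_range_iff_exists_fun]
  constructor
  · rintro ⟨c, rfl⟩
    exact ⟨c 0, c 1, c 2, by simp [Fin.sum_univ_three, basisB]⟩
  · rintro ⟨i, j, n, rfl⟩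
    exact ⟨![i, j, n], by simp [Fin.sum_univ_three, basisB]⟩

theorem mem_span_basisB_of_mem_adjoin (h : IsSimplestCubicField K a ρ) {p : ℕ} (hp : p ≠ 0)
    {k l : ℤ} {z : K} (hz : z ∈ Algebra.adjoin ℤ {ρ}) :
    z ∈ Submodule.span ℤ (Set.range (basisB ρ p k l)) := by
  obtain ⟨i, j, n, rfl⟩ := h.mem_adjoin_iff.1 hz
  refine mem_span_basisB_iff.2 ⟨i - n * k, j - n * l, n * p, ?_⟩
  have : (p : K) ≠ 0 := by exact_mod_cast hp
  push_cast
  field_simp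
  ring

theorem smul_mem_adjoin_of_mem_span_basisB (h : IsSimplestCubicField K a ρ) {p : ℕ} (hp : p ≠ 0)
    {k l : ℤ} {z : K} (hz : z ∈ Submodule.span ℤ (Set.range (basisB ρ p k l))) :
    (p : ℤ) • z ∈ Algebra.adjoin ℤ {ρ} := by
  obtain ⟨i, j, n, rfl⟩ := mem_span_basisB_iff.1 hz
  refine h.mem_adjoin_iff.2 ⟨p * i + n * k, p * j + n * l, n, ?_⟩
  have : (p : K) ≠ 0 := by exact_mod_cast hp
  rw [zsmul_eq_mul]
  push_cast
  field_simp
  ring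

/-- The family `B_p(k, l)` is linearly independent, so it is an integral basis once its last member
is integral and it spans all integral elements. -/
theorem isIntegralBasis_basisB (h : IsSimplestCubicField K a ρ) {p : ℕ} (hp : p ≠ 0) {k l : ℤ}
    (hθ : IsIntegral ℤ (((k : K) + l * ρ + ρ ^ 2) / p))
    (hspan : ∀ z : K, IsIntegral ℤ z → z ∈ Submodule.span ℤ (Set.range (basisB ρ p k l))) :
    IsIntegralBasis (basisB ρ p k l) := by
  have hp0 : (p : K) ≠ 0 := by exact_mod_cast hp
  set θ : K := ((k : K) + l * ρ + ρ ^ 2) / p with hθdef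
  have hpθ : p * θ = k + l * ρ + ρ ^ 2 := by rw [hθdef]; field_simp
  let v : Fin 3 → 𝓞 K := ![1, ⟨ρ, h.isIntegral⟩, ⟨θ, hθ⟩]
  have hv : ∀ i, (v i : K) = basisB ρ p k l i := by
    intro i; fin_cases i <;> rfl
  have hli : LinearIndependent ℤ v := by
    rw [Fintype.linearIndependent_iff]
    intro g hg
    have hg' : (g 0 : K) + g 1 * ρ + g 2 * θ = 0 := by
      have := congrArg (algebraMap (𝓞 K) K) hg
      rw [map_sum, Fin.sum_univ_three] at this
      simp only [zsmul_eq_mul, map_mul, map_intCast, hv, map_zero] at this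
      rw [hθdef]
      simpa [basisB] using this
    obtain ⟨e0, e1, e2⟩ := h.eq_zero_of_combination (i := p * g 0 + g 2 * k)
      (j := p * g 1 + g 2 * l) (k := g 2) (by
        push_cast
        linear_combination p * hg' - g 2 * hpθ)
    have hpZ : (p : ℤ) ≠ 0 := by exact_mod_cast hp
    simp only [e2, zero_mul, add_zero, mul_eq_zero, hpZ, false_or] at e0 e1
    intro i
    fin_cases i <;> assumption
  have hsp : ⊤ ≤ Submodule.span ℤ (Set.range v) := by
    rintro z -
    obtain ⟨i, j, n, hz⟩ := mem_span_basisB_iff.1 (hspan z z.2)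
    rw [Submodule.mem_span_range_iff_exists_fun]
    refine ⟨![i, j, n], RingOfIntegers.ext ?_⟩
    rw [hz, RingOfIntegers.coe_eq_algebraMap, map_sum, Fin.sum_univ_three]
    simp only [zsmul_eq_mul, map_mul, map_intCast, hv]
    simp [basisB]
  exact ⟨Module.Basis.mk hli hsp, fun i => by rw [Module.Basis.mk_apply, hv]⟩

theorem exists_eq_of_isIntegralBasis {p : ℕ} {k l : ℤ} (hB : IsIntegralBasis (basisB ρ p k l))
    {z : K} (hz : IsIntegral ℤ z) :
    ∃ i j n : ℤ, z = i + j * ρ + n * ((k + l * ρ + ρ ^ 2) / p) := by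
  obtain ⟨B, hB⟩ := hB
  refine ⟨B.repr ⟨z, hz⟩ 0, B.repr ⟨z, hz⟩ 1, B.repr ⟨z, hz⟩ 2, ?_⟩
  have := congrArg (algebraMap (𝓞 K) K) (B.sum_repr ⟨z, hz⟩)
  rw [map_sum, Fin.sum_univ_three] at this
  simp only [zsmul_eq_mul, map_mul, hB, map_intCast] at this
  refine Eq.trans ?_ (this.symm.trans ?_)
  · rfl
  · simp [basisB]

theorem mem_moduleIndex_subgroup {K : Type*} [Field K] {ρ : K} {z : 𝓞 K} :
    z ∈ (Algebra.adjoin ℤ {ρ}).toSubring.toAddSubgroup.comap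
      (algebraMap (𝓞 K) K).toAddMonoidHom ↔ (z : K) ∈ Algebra.adjoin ℤ {ρ} := Iff.rfl

/-- If `B_p(k, l)` is an integral basis, then `ℤ[ρ]` is the kernel of the reduction modulo `p` of
the last coordinate. -/
theorem moduleIndex_eq_of_isIntegralBasis (h : IsSimplestCubicField K a ρ) {p : ℕ} (hp : p ≠ 0)
    {k l : ℤ} (hB : IsIntegralBasis (basisB ρ p k l)) : moduleIndex ρ = p := by
  obtain ⟨B, hB⟩ := hB
  have hp0 : (p : K) ≠ 0 := by exact_mod_cast hp
  let φ : 𝓞 K →+ ZMod p := (Int.castAddHom (ZMod p)).comp (B.coord 2).toAddMonoidHom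
  have hφ : ∀ z, φ z = (B.repr z 2 : ZMod p) := fun z => rfl
  have hker : (Algebra.adjoin ℤ {ρ}).toSubring.toAddSubgroup.comap
      (algebraMap (𝓞 K) K).toAddMonoidHom = φ.ker := by
    ext z
    rw [mem_moduleIndex_subgroup, AddMonoidHom.mem_ker, hφ, ZMod.intCast_zmod_eq_zero_iff_dvd]
    have hz : (z : K) = B.repr z 0 + B.repr z 1 * ρ
        + B.repr z 2 * (((k : K) + l * ρ + ρ ^ 2) / p) := by
      have := congrArg (algebraMap (𝓞 K) K) (B.sum_repr z)
      rw [map_sum, Fin.sum_univ_three] at this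
      simp only [zsmul_eq_mul, map_mul, hB, map_intCast] at this
      simpa [basisB] using this.symm
    generalize B.repr z 0 = x0 at hz
    generalize B.repr z 1 = x1 at hz
    generalize B.repr z 2 = x2 at hz ⊢
    rw [hz]
    constructor
    · intro hmem
      obtain ⟨i, j, n, e⟩ := h.mem_adjoin_iff.1 hmem
      have := h.eq_zero_of_combination (i := p * (x0 - i) + x2 * k) (j := p * (x1 - j) + x2 * l)
        (k := x2 - p * n) (by
          field_simp at e
          push_cast
          linear_combination e)
      exact ⟨n, by linarith [this.2.2]⟩
    · rintro ⟨n, rfl⟩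
      refine h.mem_adjoin_iff.2 ⟨x0 + n * k, x1 + n * l, n, ?_⟩
      push_cast
      field_simp
      ring
  have hsurj : Function.Surjective φ := by
    intro x
    obtain ⟨n, rfl⟩ := ZMod.intCast_surjective x
    refine ⟨n • B 2, ?_⟩
    rw [hφ, map_zsmul]
    simp
  rw [moduleIndex, hker, AddSubgroup.index_ker, AddMonoidHom.range_eq_top.2 hsurj]
  simp [Nat.card_zmod]

theorem smul_mem_adjoin_of_moduleIndex {n : ℕ} (hn : moduleIndex ρ = n) {z : K}
    (hz : IsIntegral ℤ z) : (n : ℤ) • z ∈ Algebra.adjoin ℤ {ρ} := by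
  obtain ⟨x, rfl⟩ : ∃ x : 𝓞 K, (x : K) = z := ⟨⟨z, hz⟩, rfl⟩
  subst hn
  have := mem_moduleIndex_subgroup.1 (AddSubgroup.nsmul_index_mem
    ((Algebra.adjoin ℤ {ρ}).toSubring.toAddSubgroup.comap
      (algebraMap (𝓞 K) K).toAddMonoidHom) x)
  rw [natCast_zsmul]
  rw [RingOfIntegers.coe_eq_algebraMap, map_nsmul] at this
  exact this

theorem exists_notMem_adjoin_of_moduleIndex_ne_one (hn : moduleIndex ρ ≠ 1) :
    ∃ z : K, IsIntegral ℤ z ∧ z ∉ Algebra.adjoin ℤ {ρ} := by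
  by_contra! hall
  refine hn (AddSubgroup.index_eq_one.2 ((AddSubgroup.eq_top_iff' _).2 fun z => ?_))
  exact hall z z.2

end IsSimplestCubicField

theorem isIntegral_of_isCoprime_zsmul {A : Type*} [CommRing A] {m n : ℤ} (hmn : IsCoprime m n)
    {z : A} (hm : IsIntegral ℤ (m • z)) (hn : IsIntegral ℤ (n • z)) : IsIntegral ℤ z :=
  Subalgebra.mem_of_isCoprime_zsmul_mem (integralClosure ℤ A) hmn hm hn

theorem Nat.Prime.not_dvd_of_dvd_simplestCubicDelta {q : ℕ} (hq : q.Prime) (hq3 : q ≠ 3) {a : ℤ}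
    (h : (q : ℤ) ∣ simplestCubicDelta a) : ¬ (q : ℤ) ∣ a := by
  intro h'
  have h9 : (q : ℤ) ∣ (3 : ℕ) ^ 2 := by
    have e : ((3 : ℕ) : ℤ) ^ 2 = simplestCubicDelta a - a * (a + 3) := by
      unfold simplestCubicDelta; push_cast; ring
    rw [e]
    exact Int.dvd_sub h (h'.mul_right _)
  have := (Nat.prime_iff_prime_int.1 hq).dvd_of_dvd_pow h9
  exact hq3 ((Nat.prime_dvd_prime_iff_eq hq Nat.prime_three).1 (by exact_mod_cast this))

theorem exists_nine_mul_eq {p : ℕ} (hp : p.Prime) (hp3 : p ≠ 3) {c : ℤ} (hc : ¬ (p : ℤ) ∣ c) :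
    ∃ k k' : ℤ, 1 ≤ k ∧ k ≤ p - 1 ∧ 9 * k = c + p * k' := by
  obtain ⟨u, v, huv⟩ := hp.isCoprime_int_nine hp3
  have hp0 : (0 : ℤ) < p := by exact_mod_cast hp.pos
  have hdiv := Int.emod_add_mul_ediv (c * u) p
  have hk : 9 * (c * u % p) = c + p * (-c * v - 9 * (c * u / p)) := by
    linear_combination 9 * hdiv + c * huv
  refine ⟨c * u % p, _, ?_, ?_, hk⟩
  · refine lt_of_le_of_ne (Int.emod_nonneg _ hp0.ne') fun h0 => hc ?_
    rw [← h0] at hk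
    exact ⟨-(-c * v - 9 * (c * u / p)), by linarith⟩
  · have := Int.emod_lt_of_pos (c * u) hp0
    omega

namespace IsSimplestCubicField

variable {K : Type u} [Field K] [NumberField K] {a : ℤ} {ρ : K}

/-- If `ℤ[ρ]` has index a power of `p` and the lattice spanned by `B_p(k, l)` contains `ℤ[w]` for
some generator `w` that is Eisenstein at `p`, then this lattice is the whole ring of integers. -/
theorem isIntegralBasis_of_eisenstein (h : IsSimplestCubicField K a ρ) {p : ℕ} (hp : p.Prime)
    {k l : ℤ} (hθ : IsIntegral ℤ (((k : K) + l * ρ + ρ ^ 2) / p)) {w : K} {b c d : ℤ}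
    (hw : w ^ 3 = b * w ^ 2 + c * w + d) (hb : (p : ℤ) ∣ b) (hc : (p : ℤ) ∣ c)
    (hd : (p : ℤ) ∣ d) (hd2 : ¬ (p : ℤ) ^ 2 ∣ d)
    (hwL : w ∈ Submodule.span ℤ (Set.range (basisB ρ p k l)))
    (hw2L : w ^ 2 ∈ Submodule.span ℤ (Set.range (basisB ρ p k l)))
    {N : ℤ} (hN0 : N ≠ 0)
    (hN : ∀ z ∈ Algebra.adjoin ℤ {ρ}, N • z ∈ Algebra.adjoin ℤ {w})
    (hsat : ∀ q : ℕ, q.Prime → q ≠ p → ∀ z : K, IsIntegral ℤ z →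
      (q : ℤ) • z ∈ Algebra.adjoin ℤ {ρ} → z ∈ Algebra.adjoin ℤ {ρ}) :
    IsIntegralBasis (basisB ρ p k l) := by
  refine h.isIntegralBasis_basisB hp.ne_zero hθ fun z hz => ?_
  set S := (Submodule.span ℤ (Set.range (basisB ρ p k l))).toAddSubgroup with hS
  have hρS : ∀ x ∈ Algebra.adjoin ℤ {ρ}, x ∈ S := fun x hx =>
    h.mem_span_basisB_of_mem_adjoin hp.ne_zero hx
  have hwS : ∀ x ∈ Algebra.adjoin ℤ {w}, x ∈ S := by
    intro x hx
    obtain ⟨i, j, n, rfl⟩ := (mem_adjoin_int_of_cubic hw).1 hx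
    refine S.add_mem (S.add_mem (hρS _ (intCast_mem _ i)) ?_) ?_
    · rw [← zsmul_eq_mul]; exact S.zsmul_mem hwL j
    · rw [← zsmul_eq_mul]; exact S.zsmul_mem hw2L n
  refine S.mem_of_saturated_prime (integralClosure ℤ K).toSubring.toAddSubgroup ?_
    (n := (simplestCubicDelta a ^ 3).natAbs)
    (Int.natAbs_ne_zero.2 (pow_ne_zero 3 (simplestCubicDelta_pos a).ne')) z hz ?_
  · intro q hq x hx hqx
    by_cases hqp : q = p
    · subst hqp
      have hmem : (N * (q * q)) • x ∈ Algebra.adjoin ℤ {w} := by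
        rw [mul_smul, mul_smul]
        exact hN _ (h.smul_mem_adjoin_of_mem_span_basisB hq.ne_zero hqx)
      have hq0 : (q : ℤ) ≠ 0 := by exact_mod_cast hq.ne_zero
      obtain ⟨m', hm', hmx⟩ := exists_isCoprime_smul_mem_adjoin_of_eisenstein h.finrank_eq hw hq
        hb hc hd hd2 hx (mul_ne_zero hN0 (mul_ne_zero hq0 hq0)) hmem
      exact S.mem_of_isCoprime_zsmul_mem hm' (hwS _ hmx) hqx
    · have hpx : (p : ℤ) • x ∈ S := by
        refine hρS _ (hsat q hq hqp _ (hx.smul _) ?_)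
        rw [smul_comm]
        exact h.smul_mem_adjoin_of_mem_span_basisB hp.ne_zero hqx
      refine S.mem_of_isCoprime_zsmul_mem ?_ hqx hpx
      exact Nat.isCoprime_iff_coprime.2 ((Nat.coprime_primes hq hp).2 hqp)
  · rw [Int.natAbs_of_nonneg (pow_pos (simplestCubicDelta_pos a) 3).le]
    exact hρS _ (h.delta_pow_smul_mem hz)

/-! ### Integral elements at primes whose square divides `Δ` -/

/-- If `Δ = p² D`, then `w = (3ρ - a)² / p` is a root of a polynomial which is Eisenstein at `p`
when `p ∤ 3 D`. -/
theorem sq_div_pow_three (h : IsSimplestCubicField K a ρ) {p : ℕ} (hp : p ≠ 0) {D : ℤ}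
    (hD : simplestCubicDelta a = p ^ 2 * D) :
    ((3 * ρ - a) ^ 2 / p) ^ 3 = (6 * p * D : ℤ) * ((3 * ρ - a) ^ 2 / p) ^ 2
      + (-9 * p ^ 2 * D ^ 2 : ℤ) * ((3 * ρ - a) ^ 2 / p)
      + (p * (D ^ 2 * (2 * a + 3) ^ 2) : ℤ) := by
  have hp0 : (p : K) ≠ 0 := by exact_mod_cast hp
  have hy := h.three_mul_sub_pow_three
  rw [hD] at hy
  generalize 3 * ρ - (a : K) = y at hy ⊢
  push_cast at hy ⊢
  field_simp
  linear_combination (y ^ 3 - 3 * p ^ 2 * D * y + p ^ 2 * D * (2 * a + 3)) * hy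

/-- If `Δ = p³ E`, then `(3ρ - a)² / p²` is integral. -/
theorem isIntegral_sq_div_sq (h : IsSimplestCubicField K a ρ) {p : ℕ} (hp : p ≠ 0)
    (hΔ : (p : ℤ) ^ 3 ∣ simplestCubicDelta a) : IsIntegral ℤ ((3 * ρ - a) ^ 2 / p ^ 2 : K) := by
  obtain ⟨E, hE⟩ := hΔ
  have hp0 : (p : K) ≠ 0 := by exact_mod_cast hp
  have hy := h.three_mul_sub_pow_three
  rw [hE] at hy
  generalize 3 * ρ - (a : K) = y at hy ⊢
  refine isIntegral_of_cubic (b := 6 * p * E) (c := -9 * p ^ 2 * E ^ 2)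
    (d := E ^ 2 * (2 * a + 3) ^ 2) ?_
  push_cast at hy ⊢
  field_simp
  linear_combination (y ^ 3 - 3 * p ^ 3 * E * y + p ^ 3 * E * (2 * a + 3)) * hy

/-- With `a = 9t + 3`, the element `w = (ρ - 3t - 1)² / 3` is a root of a polynomial which is
Eisenstein at `3` when `3 ∤ 2t + 1`. -/
theorem sq_div_three_pow_three (h : IsSimplestCubicField K a ρ) {t : ℤ} (ht : a = 9 * t + 3) :
    ((ρ - (3 * t + 1)) ^ 2 / 3) ^ 3 =
      (6 * (3 * t ^ 2 + 3 * t + 1) : ℤ) * ((ρ - (3 * t + 1)) ^ 2 / 3) ^ 2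
      + (-9 * (3 * t ^ 2 + 3 * t + 1) ^ 2 : ℤ) * ((ρ - (3 * t + 1)) ^ 2 / 3)
      + (3 * ((3 * t ^ 2 + 3 * t + 1) ^ 2 * (2 * t + 1) ^ 2) : ℤ) := by
  have h3 := h.pow_three
  subst ht
  have hx : (ρ - (3 * t + 1)) ^ 3 = 9 * (3 * t ^ 2 + 3 * t + 1) * (ρ - (3 * t + 1))
      + 9 * (3 * t ^ 2 + 3 * t + 1) * (2 * t + 1) := by
    push_cast at h3
    linear_combination h3
  generalize ρ - (3 * t + 1 : K) = x at hx ⊢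
  push_cast
  generalize (3 * t ^ 2 + 3 * t + 1 : K) = s at hx ⊢
  field_simp
  linear_combination (x ^ 3 - 9 * s * x + 9 * s * (2 * t + 1)) * hx

/-- For `a ≡ 12 (mod 27)`, the element `(ρ - a / 3) / 3` is integral. -/
theorem isIntegral_sub_div_three (h : IsSimplestCubicField K a ρ) {r : ℤ} (hr : a = 27 * r + 12) :
    IsIntegral ℤ ((ρ - (9 * r + 4)) / 3 : K) := by
  have h3 := h.pow_three
  subst hr
  refine isIntegral_of_cubic (b := 0) (c := 27 * r ^ 2 + 27 * r + 7)
    (d := (27 * r ^ 2 + 27 * r + 7) * (2 * r + 1)) ?_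
  push_cast at h3 ⊢
  field_simp
  linear_combination h3

/-! ### The integral basis when `Δ` is almost square-free -/

/-- With `9k ≡ a²` and `9l ≡ -6a` modulo `p`, the lattice spanned by `B_p(k, l)` contains
`(3ρ - a)² / p`, which is Eisenstein at `p`. -/
theorem exists_isIntegralBasis (h : IsSimplestCubicField K a ρ) {p : ℕ} (hp : p.Prime)
    (hp3 : 3 < p) (hΔ : (p : ℤ) ^ 2 ∣ simplestCubicDelta a)
    (hΔ3 : ¬ (p : ℤ) ^ 3 ∣ simplestCubicDelta a)
    (hsq : ∀ q : ℕ, q.Prime → q ≠ 3 → q ≠ p → ¬ (q : ℤ) ^ 2 ∣ simplestCubicDelta a)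
    (ha : a % 9 ≠ 3) :
    ∃ k l : ℤ, 1 ≤ k ∧ k ≤ p - 1 ∧ 1 ≤ l ∧ l ≤ p - 1 ∧ IsIntegralBasis (basisB ρ p k l) := by
  have hpZ : Prime (p : ℤ) := Nat.prime_iff_prime_int.1 hp
  have hp0 : (p : K) ≠ 0 := by exact_mod_cast hp.ne_zero
  have hpa : ¬ (p : ℤ) ∣ a := fun hdvd =>
    hp.not_dvd_of_dvd_simplestCubicDelta hp3.ne' ((dvd_pow_self _ two_ne_zero).trans hΔ) hdvd
  obtain ⟨k, k', hk1, hkp, hk⟩ := exists_nine_mul_eq hp hp3.ne' (c := a ^ 2)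
    (fun hdvd => hpa (hpZ.dvd_of_dvd_pow hdvd))
  obtain ⟨l, l', hl1, hlp, hl⟩ := exists_nine_mul_eq hp hp3.ne' (c := -6 * a) (by
    intro hdvd
    rcases hpZ.dvd_or_dvd hdvd with h6 | h6
    · have h6' : p ∣ 2 * 3 := by
        have : (p : ℤ) ∣ 6 := by simpa using h6
        exact_mod_cast this
      rcases hp.dvd_mul.1 h6' with h2 | h2
      · exact absurd (Nat.le_of_dvd (by norm_num) h2) (by omega)
      · exact absurd (Nat.le_of_dvd (by norm_num) h2) (by omega)
    · exact hpa h6)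
  refine ⟨k, l, hk1, hkp, hl1, hlp, ?_⟩
  obtain ⟨D, hD⟩ := hΔ
  have hpD : ¬ (p : ℤ) ∣ D := fun ⟨E, hE⟩ => hΔ3 ⟨E, by rw [hD, hE]; ring⟩
  have hpm : ¬ (p : ℤ) ∣ 2 * a + 3 :=
    hp.not_dvd_two_mul_add_three hp3.ne' (hD ▸ (dvd_pow_self _ two_ne_zero).mul_right D)
  have hD0 : D ≠ 0 := fun h0 => hpD (h0 ▸ dvd_zero _)
  have hm0 : 2 * a + 3 ≠ 0 := fun h0 => hpm (h0 ▸ dvd_zero _)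
  have hw := h.sq_div_pow_three hp.ne_zero hD
  have hwsq : ((3 * ρ - a) ^ 2 / p) ^ 2 = (3 * p * D : ℤ) * ((3 * ρ - a) ^ 2 / p)
      + (D * (2 * a + 3) : ℤ) * (3 * ρ - a) := by
    have hy := h.three_mul_sub_pow_three
    rw [hD] at hy
    push_cast at hy ⊢
    field_simp
    linear_combination (3 * ρ - a) * hy
  have h9 : (3 * ρ - a) ^ 2 / p = (-k' : ℤ) + (-l' : ℤ) * ρ
      + (9 : ℤ) * (((k : K) + l * ρ + ρ ^ 2) / p) := by
    have hkK : (9 * k : K) = a ^ 2 + p * k' := by exact_mod_cast hk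
    have hlK : (9 * l : K) = -6 * a + p * l' := by exact_mod_cast hl
    push_cast
    field_simp
    linear_combination -hkK - ρ * hlK
  set w : K := (3 * ρ - a) ^ 2 / p with hwdef
  have hwint : IsIntegral ℤ w := isIntegral_of_cubic hw
  have hwL : w ∈ Submodule.span ℤ (Set.range (basisB ρ p k l)) :=
    mem_span_basisB_iff.2 ⟨_, _, _, h9⟩
  have hyL : 3 * ρ - a ∈ Submodule.span ℤ (Set.range (basisB ρ p k l)) :=
    h.mem_span_basisB_of_mem_adjoin hp.ne_zero (h.mem_adjoin_iff.2
      ⟨-a, 3, 0, by push_cast; ring⟩)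
  refine h.isIntegralBasis_of_eisenstein hp (w := w) ?_ hw
    (N := 9 * (D * (2 * a + 3))) ?_ ?_ ?_ ?_ hwL ?_ ?_ ?_ ?_
  · -- `9 θ` and `p θ` are integral
    refine isIntegral_of_isCoprime_zsmul (hp.isCoprime_int_nine hp3.ne') ?_ ?_
    · have : (9 : ℤ) • (((k : K) + l * ρ + ρ ^ 2) / p) = w + (k' : ℤ) • 1 + (l' : ℤ) • ρ := by
        rw [h9]
        simp only [zsmul_eq_mul]
        push_cast
        ring
      rw [this]
      exact (hwint.add (isIntegral_one.smul _)).add (h.isIntegral.smul _)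
    · have : (p : ℤ) • (((k : K) + l * ρ + ρ ^ 2) / p) = (k : ℤ) • 1 + (l : ℤ) • ρ + ρ ^ 2 := by
        simp only [zsmul_eq_mul]
        push_cast
        field_simp
      rw [this]
      exact ((isIntegral_one.smul _).add (h.isIntegral.smul _)).add (h.isIntegral.pow 2)
  · exact ⟨6 * D, by ring⟩
  · exact ⟨-9 * p * D ^ 2, by ring⟩
  · exact dvd_mul_right _ _
  · intro hdvd
    have h1 : (p : ℤ) ∣ D ^ 2 * (2 * a + 3) ^ 2 := by
      rw [pow_two (p : ℤ)] at hdvd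
      exact (mul_dvd_mul_iff_left hpZ.ne_zero).1 hdvd
    rcases hpZ.dvd_or_dvd h1 with h2 | h2
    · exact hpD (hpZ.dvd_of_dvd_pow h2)
    · exact hpm (hpZ.dvd_of_dvd_pow h2)
  · rw [hwsq, ← zsmul_eq_mul, ← zsmul_eq_mul]
    exact add_mem (Submodule.smul_mem _ _ hwL) (Submodule.smul_mem _ _ hyL)
  · exact mul_ne_zero (by norm_num) (mul_ne_zero hD0 hm0)
  · intro z hz
    obtain ⟨i, j, n, rfl⟩ := h.mem_adjoin_iff.1 hz
    -- with `y = 3ρ - a`, both `D (2a + 3) y = w² - 3 p D w` and `y² = p w` lie in `ℤ[w]`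
    refine (mem_adjoin_int_of_cubic hw).2
      ⟨D * (2 * a + 3) * (9 * i + 3 * j * a + n * a ^ 2),
        (3 * j + 2 * n * a) * (-3 * p * D) + n * p * (D * (2 * a + 3)),
        3 * j + 2 * n * a, ?_⟩
    have hy : (3 * ρ - a) ^ 2 = p * w := by rw [hwdef]; field_simp
    rw [zsmul_eq_mul]
    push_cast at hwsq ⊢
    linear_combination (-(3 * j + 2 * n * a) : K) * hwsq + n * (D * (2 * a + 3)) * hy
  · intro q hq hqp z hz hqz
    by_cases hq3 : q = 3
    · subst hq3
      exact h.mem_adjoin_of_three_smul ha hz hqz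
    · exact h.mem_adjoin_of_prime_smul hq hq3 (hsq q hq hq3 hqp) hz hqz

/-- The lattice spanned by `B_3(1, 1)` contains `(ρ - a / 3)² / 3`, which is Eisenstein at `3`. -/
theorem isIntegralBasis_three (h : IsSimplestCubicField K a ρ) (ha : a % 9 = 3) (ha' : a % 27 ≠ 12)
    (hsq : ∀ q : ℕ, q.Prime → q ≠ 3 → ¬ (q : ℤ) ^ 2 ∣ simplestCubicDelta a) :
    IsIntegralBasis (basisB ρ 3 1 1) := by
  obtain ⟨t, ht⟩ : ∃ t, a = 9 * t + 3 := ⟨a / 9, by omega⟩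
  have hw := h.sq_div_three_pow_three ht
  have ht1 : ¬ (3 : ℤ) ∣ 2 * t + 1 := by omega
  have hs1 : ¬ (3 : ℤ) ∣ 3 * t ^ 2 + 3 * t + 1 := by omega
  have hx2 : (ρ - (3 * t + 1)) ^ 2 / 3 =
      (t * (3 * t + 2) : ℤ) + (-(2 * t + 1) : ℤ) * ρ
        + (1 : ℤ) * ((((1 : ℤ) : K) + (1 : ℤ) * ρ + ρ ^ 2) / (3 : ℕ)) := by
    push_cast
    field_simp
    ring
  have hwsq : ((ρ - (3 * t + 1)) ^ 2 / 3) ^ 2 =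
      (3 * (3 * t ^ 2 + 3 * t + 1) : ℤ) * ((ρ - (3 * t + 1)) ^ 2 / 3)
        + ((3 * t ^ 2 + 3 * t + 1) * (2 * t + 1) : ℤ) * (ρ - (3 * t + 1)) := by
    have h3 := h.pow_three
    subst ht
    push_cast at h3 ⊢
    field_simp
    linear_combination (ρ - (3 * t + 1)) * h3
  set w : K := (ρ - (3 * t + 1)) ^ 2 / 3 with hwdef
  have hwint : IsIntegral ℤ w := isIntegral_of_cubic hw
  have hwL : w ∈ Submodule.span ℤ (Set.range (basisB ρ 3 1 1)) := mem_span_basisB_iff.2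
    ⟨_, _, _, hx2⟩
  have hxL : ρ - (3 * t + 1) ∈ Submodule.span ℤ (Set.range (basisB ρ 3 1 1)) :=
    h.mem_span_basisB_of_mem_adjoin three_ne_zero (h.mem_adjoin_iff.2
      ⟨-(3 * t + 1), 1, 0, by push_cast; ring⟩)
  refine h.isIntegralBasis_of_eisenstein Nat.prime_three (w := w) ?_ hw
    (N := (3 * t ^ 2 + 3 * t + 1) * (2 * t + 1)) ?_ ?_ ?_ ?_ hwL ?_ ?_ ?_ ?_
  · have : (((1 : ℤ) : K) + (1 : ℤ) * ρ + ρ ^ 2) / (3 : ℕ) =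
        w - (t * (3 * t + 2) : ℤ) • 1 + (2 * t + 1 : ℤ) • ρ := by
      rw [hx2]
      simp only [zsmul_eq_mul]
      push_cast
      ring
    rw [this]
    exact (hwint.sub (isIntegral_one.smul _)).add (h.isIntegral.smul _)
  · push_cast; omega
  · exact ⟨-3 * (3 * t ^ 2 + 3 * t + 1) ^ 2, by push_cast; ring⟩
  · exact dvd_mul_right _ _
  · intro hdvd
    have h1 : ((3 : ℕ) : ℤ) ∣ (3 * t ^ 2 + 3 * t + 1) ^ 2 * (2 * t + 1) ^ 2 := by
      rw [pow_two] at hdvd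
      exact (mul_dvd_mul_iff_left (by norm_num)).1 hdvd
    rcases Int.prime_three.dvd_or_dvd h1 with h2 | h2
    · exact hs1 (Int.prime_three.dvd_of_dvd_pow h2)
    · exact ht1 (Int.prime_three.dvd_of_dvd_pow h2)
  · rw [hwsq, ← zsmul_eq_mul, ← zsmul_eq_mul]
    exact add_mem (Submodule.smul_mem _ _ hwL) (Submodule.smul_mem _ _ hxL)
  · exact mul_ne_zero (fun h0 => hs1 (h0 ▸ dvd_zero _)) (fun h0 => ht1 (h0 ▸ dvd_zero _))
  · intro z hz
    obtain ⟨i, j, k, rfl⟩ := h.mem_adjoin_iff.1 hz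
    -- with `x = ρ - (3t + 1)`, both `N x = w² - 3 s w` and `x² = 3 w` lie in `ℤ[w]`
    refine (mem_adjoin_int_of_cubic hw).2
      ⟨(3 * t ^ 2 + 3 * t + 1) * (2 * t + 1) * (i + j * (3 * t + 1) + k * (3 * t + 1) ^ 2),
        (j + 2 * k * (3 * t + 1)) * (-3 * (3 * t ^ 2 + 3 * t + 1))
          + 3 * k * ((3 * t ^ 2 + 3 * t + 1) * (2 * t + 1)),
        j + 2 * k * (3 * t + 1), ?_⟩
    have hx : (ρ - (3 * t + 1)) ^ 2 = 3 * w := by rw [hwdef]; field_simp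
    rw [zsmul_eq_mul]
    push_cast at hwsq ⊢
    linear_combination (-(j + 2 * k * (3 * t + 1)) : K) * hwsq
      + k * ((3 * t ^ 2 + 3 * t + 1) * (2 * t + 1)) * hx
  · intro q hq hq3 z hz hqz
    exact h.mem_adjoin_of_prime_smul hq hq3 (hsq q hq hq3) hz hqz

end IsSimplestCubicField

/-! ### The index in terms of `Δ` -/

namespace IsSimplestCubicField

variable {K : Type u} [Field K] [NumberField K] {a : ℤ} {ρ : K}

/-- The index of `ℤ[ρ]` is divisible by every prime `q ≠ 3` with `q² ∣ Δ`, because of the integral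
element `(3ρ - a)² / q`. -/
theorem not_sq_dvd_of_smul_mem_adjoin (h : IsSimplestCubicField K a ρ) {p q : ℕ} (hp : p.Prime)
    (hq : q.Prime) (hq3 : q ≠ 3) (hqp : q ≠ p)
    (hall : ∀ z : K, IsIntegral ℤ z → (p : ℤ) • z ∈ Algebra.adjoin ℤ {ρ}) :
    ¬ (q : ℤ) ^ 2 ∣ simplestCubicDelta a := by
  rintro ⟨D, hD⟩
  have hq0 : (q : K) ≠ 0 := by exact_mod_cast hq.ne_zero
  have hint := isIntegral_of_cubic (h.sq_div_pow_three hq.ne_zero hD)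
  have hmem : (3 * ρ - a) ^ 2 / q ∈ Algebra.adjoin ℤ {ρ} := by
    refine Subalgebra.mem_of_isCoprime_zsmul_mem _ (m := p) (n := q)
      (Nat.isCoprime_iff_coprime.2 ((Nat.coprime_primes hp hq).2 hqp.symm)) (hall _ hint) ?_
    refine h.mem_adjoin_iff.2 ⟨a ^ 2, -6 * a, 9, ?_⟩
    rw [zsmul_eq_mul]
    push_cast
    field_simp
    ring
  obtain ⟨i, j, k, e⟩ := h.mem_adjoin_iff.1 hmem
  have := h.eq_zero_of_combination (i := q * i - a ^ 2) (j := q * j + 6 * a) (k := q * k - 9) (by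
    field_simp at e
    push_cast
    linear_combination -e)
  obtain ⟨u, v, huv⟩ := hq.isCoprime_int_nine hq3
  refine (Nat.prime_iff_prime_int.1 hq).not_isUnit (IsUnit.of_mul_eq_one (k * u + v) ?_)
  linear_combination huv + u * this.2.2

theorem not_pow_three_dvd_of_smul_mem_adjoin (h : IsSimplestCubicField K a ρ) {p : ℕ}
    (hp : p.Prime) (hp3 : p ≠ 3)
    (hall : ∀ z : K, IsIntegral ℤ z → (p : ℤ) • z ∈ Algebra.adjoin ℤ {ρ}) :
    ¬ (p : ℤ) ^ 3 ∣ simplestCubicDelta a := by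
  intro hdvd
  have hp0 : (p : K) ≠ 0 := by exact_mod_cast hp.ne_zero
  obtain ⟨i, j, k, e⟩ := h.mem_adjoin_iff.1
    (hall _ (h.isIntegral_sq_div_sq hp.ne_zero hdvd))
  have := h.eq_zero_of_combination (i := p * i - a ^ 2) (j := p * j + 6 * a) (k := p * k - 9) (by
    rw [zsmul_eq_mul] at e
    push_cast at e
    field_simp at e
    push_cast
    linear_combination -e)
  obtain ⟨u, v, huv⟩ := hp.isCoprime_int_nine hp3
  refine (Nat.prime_iff_prime_int.1 hp).not_isUnit (IsUnit.of_mul_eq_one (k * u + v) ?_)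
  linear_combination huv + u * this.2.2

/-- The element `(ρ - a / 3)² / 3`, integral for `a ≡ 3 (mod 9)`, is not in `ℤ[ρ]`. -/
theorem sq_div_three_notMem_adjoin (h : IsSimplestCubicField K a ρ) (t : ℤ) :
    (ρ - (3 * t + 1)) ^ 2 / 3 ∉ Algebra.adjoin ℤ {ρ} := by
  intro hmem
  obtain ⟨i, j, k, e⟩ := h.mem_adjoin_iff.1 hmem
  have := h.eq_zero_of_combination (i := 3 * i - (3 * t + 1) ^ 2) (j := 3 * j + 2 * (3 * t + 1))
    (k := 3 * k - 1) (by
      field_simp at e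
      push_cast
      linear_combination -e)
  omega

theorem emod_nine_ne_three_of_smul_mem_adjoin (h : IsSimplestCubicField K a ρ) {p : ℕ}
    (hp : p.Prime) (hp3 : p ≠ 3)
    (hall : ∀ z : K, IsIntegral ℤ z → (p : ℤ) • z ∈ Algebra.adjoin ℤ {ρ}) : a % 9 ≠ 3 := by
  intro ha
  obtain ⟨t, ht⟩ : ∃ t, a = 9 * t + 3 := ⟨a / 9, by omega⟩
  refine h.sq_div_three_notMem_adjoin t (Subalgebra.mem_of_isCoprime_zsmul_mem _ (m := p) (n := 3)
    ?_ (hall _ (isIntegral_of_cubic (h.sq_div_three_pow_three ht))) ?_)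
  · exact_mod_cast Nat.isCoprime_iff_coprime.2 ((Nat.coprime_primes hp Nat.prime_three).2 hp3)
  · refine h.mem_adjoin_iff.2 ⟨(3 * t + 1) ^ 2, -2 * (3 * t + 1), 1, ?_⟩
    rw [zsmul_eq_mul]
    push_cast
    field_simp
    ring

/-- For `a ≡ 12 (mod 27)` the square of `(ρ - a / 3) / 3` has order divisible by `9` modulo
`ℤ[ρ]`. -/
theorem emod_ne_twelve_of_three_smul_mem_adjoin (h : IsSimplestCubicField K a ρ)
    (hall : ∀ z : K, IsIntegral ℤ z → (3 : ℤ) • z ∈ Algebra.adjoin ℤ {ρ}) : a % 27 ≠ 12 := by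
  intro ha
  obtain ⟨r, hr⟩ : ∃ r, a = 27 * r + 12 := ⟨a / 27, by omega⟩
  refine h.sq_div_three_notMem_adjoin (3 * r + 1) ?_
  have := hall _ ((h.isIntegral_sub_div_three hr).pow 2)
  rw [zsmul_eq_mul] at this
  convert this using 1
  push_cast
  field_simp
  ring

theorem of_moduleIndex_eq_prime (h : IsSimplestCubicField K a ρ) {p : ℕ} (hp : p.Prime)
    (hp3 : p ≠ 3) (hδ : moduleIndex ρ = p) :
    (p : ℤ) ^ 2 ∣ simplestCubicDelta a ∧ ¬ (p : ℤ) ^ 3 ∣ simplestCubicDelta a ∧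
      (∀ q : ℕ, q.Prime → q ≠ 3 → q ≠ p → ¬ (q : ℤ) ^ 2 ∣ simplestCubicDelta a) ∧ a % 9 ≠ 3 := by
  have hall : ∀ z : K, IsIntegral ℤ z → (p : ℤ) • z ∈ Algebra.adjoin ℤ {ρ} := fun z hz =>
    smul_mem_adjoin_of_moduleIndex hδ hz
  refine ⟨?_, h.not_pow_three_dvd_of_smul_mem_adjoin hp hp3 hall, fun q hq hq3 hqp =>
    h.not_sq_dvd_of_smul_mem_adjoin hp hq hq3 hqp hall,
    h.emod_nine_ne_three_of_smul_mem_adjoin hp hp3 hall⟩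
  by_contra hdvd
  obtain ⟨z, hz, hz'⟩ := exists_notMem_adjoin_of_moduleIndex_ne_one (ρ := ρ)
    (by rw [hδ]; exact hp.ne_one)
  exact hz' (h.mem_adjoin_of_prime_smul hp hp3 hdvd hz (hall z hz))

theorem of_moduleIndex_eq_three (h : IsSimplestCubicField K a ρ) (hδ : moduleIndex ρ = 3) :
    a % 9 = 3 ∧ a % 27 ≠ 12 ∧
      ∀ q : ℕ, q.Prime → q ≠ 3 → ¬ (q : ℤ) ^ 2 ∣ simplestCubicDelta a := by
  have hall : ∀ z : K, IsIntegral ℤ z → (3 : ℤ) • z ∈ Algebra.adjoin ℤ {ρ} := fun z hz =>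
    smul_mem_adjoin_of_moduleIndex hδ hz
  refine ⟨?_, h.emod_ne_twelve_of_three_smul_mem_adjoin hall, fun q hq hq3 =>
    h.not_sq_dvd_of_smul_mem_adjoin Nat.prime_three hq hq3 hq3 hall⟩
  by_contra ha
  obtain ⟨z, hz, hz'⟩ := exists_notMem_adjoin_of_moduleIndex_ne_one (ρ := ρ)
    (by rw [hδ]; norm_num)
  exact hz' (h.mem_adjoin_of_three_smul ha hz (hall z hz))

theorem moduleIndex_eq_three_iff_isIntegralBasis (h : IsSimplestCubicField K a ρ) :
    moduleIndex ρ = 3 ↔ IsIntegralBasis (basisB ρ 3 1 1) := by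
  refine ⟨fun hδ => ?_, fun hB => h.moduleIndex_eq_of_isIntegralBasis three_ne_zero hB⟩
  obtain ⟨h1, h2, h3⟩ := h.of_moduleIndex_eq_three hδ
  exact h.isIntegralBasis_three h1 h2 h3

theorem moduleIndex_eq_three_iff (h : IsSimplestCubicField K a ρ) :
    moduleIndex ρ = 3 ↔ a % 9 = 3 ∧ a % 27 ≠ 12 ∧
      ∀ q : ℕ, q.Prime → q ≠ 3 → ¬ (q : ℤ) ^ 2 ∣ simplestCubicDelta a :=
  ⟨h.of_moduleIndex_eq_three, fun ⟨h1, h2, h3⟩ =>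
    h.moduleIndex_eq_of_isIntegralBasis three_ne_zero (h.isIntegralBasis_three h1 h2 h3)⟩

theorem moduleIndex_eq_prime_iff_isIntegralBasis (h : IsSimplestCubicField K a ρ) {p : ℕ}
    (hp : p.Prime) (hp3 : 3 < p) : moduleIndex ρ = p ↔
      ∃ k l : ℤ, 1 ≤ k ∧ k ≤ p - 1 ∧ 1 ≤ l ∧ l ≤ p - 1 ∧ IsIntegralBasis (basisB ρ p k l) := by
  refine ⟨fun hδ => ?_, fun ⟨k, l, _, _, _, _, hB⟩ =>
    h.moduleIndex_eq_of_isIntegralBasis hp.ne_zero hB⟩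
  obtain ⟨h1, h2, h3, h4⟩ := h.of_moduleIndex_eq_prime hp hp3.ne' hδ
  exact h.exists_isIntegralBasis hp hp3 h1 h2 h3 h4

theorem moduleIndex_eq_prime_iff (h : IsSimplestCubicField K a ρ) {p : ℕ} (hp : p.Prime)
    (hp3 : 3 < p) : moduleIndex ρ = p ↔
      (p : ℤ) ^ 2 ∣ simplestCubicDelta a ∧ ¬ (p : ℤ) ^ 3 ∣ simplestCubicDelta a ∧
      (∀ q : ℕ, q.Prime → q ≠ 3 → q ≠ p → ¬ (q : ℤ) ^ 2 ∣ simplestCubicDelta a) ∧ a % 9 ≠ 3 := by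
  refine ⟨h.of_moduleIndex_eq_prime hp hp3.ne', fun ⟨h1, h2, h3, h4⟩ => ?_⟩
  obtain ⟨k, l, _, _, _, _, hB⟩ := h.exists_isIntegralBasis hp hp3 h1 h2 h3 h4
  exact h.moduleIndex_eq_of_isIntegralBasis hp.ne_zero hB

/-- If `p² ∣ Δ`, the coordinates of the integral element `(3ρ - a)² / p` in an integral basis
`B_p(k, l)` show that `9 k ≡ a²` and `9 l ≡ -6 a` modulo `p`. -/
theorem nine_mul_eq_of_isIntegralBasis (h : IsSimplestCubicField K a ρ) {p : ℕ} (hp : p ≠ 0)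
    (hΔ : (p : ℤ) ^ 2 ∣ simplestCubicDelta a) {k l : ℤ}
    (hB : IsIntegralBasis (basisB ρ p k l)) :
    (9 : ZMod p) * k = a ^ 2 ∧ (9 : ZMod p) * l = -6 * a := by
  obtain ⟨D, hD⟩ := hΔ
  have hp0 : (p : K) ≠ 0 := by exact_mod_cast hp
  obtain ⟨i, j, n, e⟩ := exists_eq_of_isIntegralBasis hB
    (isIntegral_of_cubic (h.sq_div_pow_three hp hD))
  obtain ⟨e0, e1, e2⟩ := h.eq_zero_of_combination (i := p * i + n * k - a ^ 2)
    (j := p * j + n * l + 6 * a) (k := n - 9) (by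
      field_simp at e
      push_cast
      linear_combination -e)
  obtain rfl : n = 9 := by linarith
  have h0 := congrArg (Int.cast : ℤ → ZMod p) e0
  have h1 := congrArg (Int.cast : ℤ → ZMod p) e1
  push_cast at h0 h1
  rw [CharP.cast_eq_zero] at h0 h1
  exact ⟨by linear_combination h0, by linear_combination h1⟩

end IsSimplestCubicField

theorem not_two_dvd_simplestCubicDelta (a : ℤ) : ¬ 2 ∣ simplestCubicDelta a := by
  have h : simplestCubicDelta a = a * (a + 1) + 2 * (a + 4) + 1 := by
    unfold simplestCubicDelta; ring
  have := (Int.even_mul_succ_self a).two_dvd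
  omega

/-- The condition for index `3` in terms of `a` and the square-freeness of `Δ / 27`. -/
theorem index_three_condition_iff {a : ℤ} (ha : -1 ≤ a) :
    (a % 9 = 3 ∧ a % 27 ≠ 12 ∧
      ∀ q : ℕ, q.Prime → q ≠ 3 → ¬ (q : ℤ) ^ 2 ∣ simplestCubicDelta a) ↔
    (a = 3 ∨ ((a ≡ 3 [ZMOD 27] ∨ a ≡ 21 [ZMOD 27]) ∧ 12 < a ∧
      Squarefree (simplestCubicDelta a / 27))) := by
  have key : ∀ t : ℤ, simplestCubicDelta (9 * t + 3) = 27 * (3 * t ^ 2 + 3 * t + 1) := by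
    intro t; unfold simplestCubicDelta; ring
  have hsf : ∀ t : ℤ, (∀ q : ℕ, q.Prime → q ≠ 3 → ¬ (q : ℤ) ^ 2 ∣ simplestCubicDelta (9 * t + 3)) ↔
      Squarefree (simplestCubicDelta (9 * t + 3) / 27) := by
    intro t
    rw [key, Int.mul_ediv_cancel_left _ (by norm_num), ← Int.squarefree_natAbs,
      Nat.squarefree_iff_prime_squarefree]
    refine forall_congr' fun q => ⟨fun hq hqp hdvd => ?_, fun hq hqp hq3 hdvd => ?_⟩
    · have hdvd' : (q : ℤ) * q ∣ 3 * t ^ 2 + 3 * t + 1 := by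
        rw [← Int.natCast_mul]; exact Int.natCast_dvd.2 hdvd
      refine hq hqp ?_ ((pow_two (q : ℤ)).symm ▸ hdvd'.mul_left _)
      rintro rfl
      have := (dvd_mul_right _ _).trans hdvd'
      push_cast at this
      omega
    · refine hq hqp (Int.natCast_dvd.1 ?_)
      have hc : IsCoprime ((q : ℤ) ^ 2) 27 := by
        have : Nat.Coprime (q ^ 2) (3 ^ 3) :=
          Nat.Coprime.pow _ _ ((Nat.coprime_primes hqp Nat.prime_three).2 hq3)
        exact_mod_cast Nat.isCoprime_iff_coprime.2 this
      have := hc.dvd_of_dvd_mul_left hdvd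
      rw [pow_two] at this
      exact_mod_cast this
  constructor
  · rintro ⟨h1, h2, h3⟩
    obtain ⟨t, rfl⟩ : ∃ t, a = 9 * t + 3 := ⟨a / 9, by omega⟩
    by_cases ht : 9 * t + 3 = 3
    · exact Or.inl ht
    · exact Or.inr ⟨by simp only [Int.ModEq]; omega, by omega, (hsf t).1 h3⟩
  · rintro (rfl | ⟨h1, h2, h3⟩)
    · exact ⟨by norm_num, by norm_num, (hsf 0).2 (by norm_num [simplestCubicDelta])⟩
    · have h1' : a % 9 = 3 ∧ a % 27 ≠ 12 := by simp only [Int.ModEq] at h1; omega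
      obtain ⟨t, rfl⟩ : ∃ t, a = 9 * t + 3 := ⟨a / 9, by omega⟩
      exact ⟨h1'.1, h1'.2, (hsf t).2 h3⟩

/-! ### Existence of simplest cubic fields -/

/-- Any field isomorphic to `ℚ[x] / (x³ - a x² - (a + 3) x - 1)` is a simplest cubic field; the
isomorphism allows a field in an arbitrary universe. -/
theorem exists_isSimplestCubicField_of_ringEquiv {a : ℤ} (ha : -1 ≤ a) {L : Type u} [Field L]
    (e : AdjoinRoot ((simplestCubicPoly a).map (Int.castRingHom ℚ)) ≃+* L) :
    ∃ (_ : NumberField L) (ρ : L), IsSimplestCubicField L a ρ := by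
  have hmon := simplestCubicPoly_monic a
  set f := (simplestCubicPoly a).map (Int.castRingHom ℚ) with hf
  have hirr : Irreducible f :=
    (hmon.irreducible_iff_irreducible_map_fraction_map (K := ℚ)).1 (simplestCubicPoly_irreducible a)
  have hdeg : f.natDegree = 3 := by rw [hf, hmon.natDegree_map, simplestCubicPoly_natDegree]
  have : Fact (Irreducible f) := ⟨hirr⟩
  have : FiniteDimensional ℚ (AdjoinRoot f) := (AdjoinRoot.powerBasis hirr.ne_zero).finite
  have : CharZero (AdjoinRoot f) := charZero_of_injective_algebraMap (algebraMap ℚ _).injective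
  have : CharZero L := charZero_of_injective_ringHom (f := (e : AdjoinRoot f →+* L)) e.injective
  let e' : AdjoinRoot f ≃ₐ[ℚ] L := e.toRatAlgEquiv
  have : NumberField L :=
    { to_charZero := inferInstance
      to_finiteDimensional := e'.toLinearEquiv.finiteDimensional }
  have hrank : Module.finrank ℚ L = 3 := by
    rw [← e'.toLinearEquiv.finrank_eq, (AdjoinRoot.powerBasis hirr.ne_zero).finrank,
      AdjoinRoot.powerBasis_dim, hdeg]
  have hroot : aeval (e' (AdjoinRoot.root f)) (simplestCubicPoly a) = 0 := by
    have h0 := congrArg (e : AdjoinRoot f →+* L) (AdjoinRoot.eval₂_root f)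
    rw [map_zero, hom_eval₂] at h0
    conv at h0 => enter [1, 3]; rw [hf]
    rw [eval₂_map] at h0
    rw [aeval_def, ← h0]
    exact congrArg (fun φ => eval₂ φ _ _) (RingHom.ext_int _ _)
  refine ⟨this, e' (AdjoinRoot.root f), ha, hroot, ?_⟩
  rw [Field.primitive_element_iff_minpoly_natDegree_eq, hrank,
    minpoly_rat_of_aeval_simplestCubicPoly hroot, ← hf, hdeg]

theorem exists_isSimplestCubicField {a : ℤ} (ha : -1 ≤ a) :
    ∃ (K : Type u) (_ : Field K) (_ : NumberField K) (ρ : K), IsSimplestCubicField K a ρ := by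
  have : Fact (Irreducible ((simplestCubicPoly a).map (Int.castRingHom ℚ))) :=
    ⟨((simplestCubicPoly_monic a).irreducible_iff_irreducible_map_fraction_map (K := ℚ)).1
      (simplestCubicPoly_irreducible a)⟩
  obtain ⟨hL, ρ, h⟩ := exists_isSimplestCubicField_of_ringEquiv ha
    (L := ULift.{u} (AdjoinRoot ((simplestCubicPoly a).map (Int.castRingHom ℚ))))
    ULift.ringEquiv.symm
  exact ⟨_, inferInstance, hL, ρ, h⟩

/-! ### Square-free values of `Δ` -/

theorem Finset.card_le_of_modEq {S : Finset ℕ} {N r : ℕ} (hr : 0 < r) (hS : S ⊆ Finset.range N)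
    (h : ∀ x ∈ S, ∀ y ∈ S, x ≡ y [MOD r]) : (S.card : ℝ) ≤ N / r + 1 := by
  rcases S.eq_empty_or_nonempty with rfl | ⟨x, hx⟩
  · simp only [Finset.card_empty, Nat.cast_zero]; positivity
  have hsub : S ⊆ (Finset.range N).filter (· ≡ x [MOD r]) := fun y hy =>
    Finset.mem_filter.2 ⟨hS hy, h y hy x hx⟩
  have h1 : S.card ≤ N / r + 1 := by
    refine (Finset.card_le_card hsub).trans ?_
    rw [← Nat.count_eq_card_filter_range, Nat.count_modEq_card _ hr]
    split_ifs <;> omega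
  have h2 : (S.card : ℝ) ≤ ((N / r : ℕ) : ℝ) + 1 := by exact_mod_cast h1
  exact h2.trans (by gcongr; exact Nat.cast_div_le)

/-- If among any three elements two are congruent, then at most two residue classes occur. -/
theorem Finset.card_le_of_modEq_or {S : Finset ℕ} {N r : ℕ} (hr : 0 < r) (hS : S ⊆ Finset.range N)
    (h : ∀ x ∈ S, ∀ y ∈ S, ∀ z ∈ S, x ≡ y [MOD r] ∨ x ≡ z [MOD r] ∨ y ≡ z [MOD r]) :
    (S.card : ℝ) ≤ 2 * (N / r + 1) := by
  rcases S.eq_empty_or_nonempty with rfl | ⟨x, hx⟩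
  · simp only [Finset.card_empty, Nat.cast_zero]; positivity
  have h1 := Finset.card_le_of_modEq (S := S.filter (x ≡ · [MOD r])) hr
    ((Finset.filter_subset _ _).trans hS) (fun y hy z hz =>
      (Finset.mem_filter.1 hy).2.symm.trans (Finset.mem_filter.1 hz).2)
  have h2 := Finset.card_le_of_modEq (S := S.filter (¬ x ≡ · [MOD r])) hr
    ((Finset.filter_subset _ _).trans hS) (fun y hy z hz => by
      rcases h x hx y (Finset.mem_filter.1 hy).1 z (Finset.mem_filter.1 hz).1 with h | h | h
      · exact absurd h (Finset.mem_filter.1 hy).2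
      · exact absurd h (Finset.mem_filter.1 hz).2
      · exact h)
  have h3 : (S.card : ℝ) = (S.filter (x ≡ · [MOD r])).card + (S.filter (¬ x ≡ · [MOD r])).card := by
    exact_mod_cast (Finset.card_filter_add_card_filter_not (s := S) (x ≡ · [MOD r])).symm
  linarith

/-- Modulo a power of a prime `q ≠ 3`, the polynomial `Δ` has at most the two roots `a` and
`-3 - a`. -/
theorem pow_dvd_sub_or_pow_dvd_add {q : ℕ} (hq : q.Prime) (hq3 : q ≠ 3) {a b : ℤ} {n : ℕ}
    (ha : (q : ℤ) ^ (n + 1) ∣ simplestCubicDelta a)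
    (hb : (q : ℤ) ^ (n + 1) ∣ simplestCubicDelta b) :
    (q : ℤ) ^ (n + 1) ∣ a - b ∨ (q : ℤ) ^ (n + 1) ∣ a + b + 3 := by
  have hqZ := Nat.prime_iff_prime_int.1 hq
  have hprod : (q : ℤ) ^ (n + 1) ∣ (a - b) * (a + b + 3) := by
    have e : (a - b) * (a + b + 3) = simplestCubicDelta a - simplestCubicDelta b := by
      unfold simplestCubicDelta; ring
    rw [e]; exact Int.dvd_sub ha hb
  by_cases hd : (q : ℤ) ∣ a - b
  · left
    have hm := hq.not_dvd_two_mul_add_three hq3 ((dvd_pow_self _ n.succ_ne_zero).trans ha)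
    have hnd : ¬ (q : ℤ) ∣ a + b + 3 := fun h' => hm (by
      have e : 2 * a + 3 = (a - b) + (a + b + 3) := by ring
      rw [e]; exact Int.dvd_add hd h')
    exact ((hqZ.coprime_iff_not_dvd.2 hnd).pow_left).dvd_of_dvd_mul_right hprod
  · right
    exact ((hqZ.coprime_iff_not_dvd.2 hd).pow_left).dvd_of_dvd_mul_left hprod

open Filter in
theorem eventually_primeCounting_le_mul (A B : ℕ) {ε : ℝ} (hε : 0 < ε) :
    ∀ᶠ N : ℕ in atTop, (Nat.primeCounting (A + B * N) : ℝ) ≤ ε * N := by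
  -- compare with a multiple of `N`: `A + B N ≤ (A + B + 1) N` for `N ≥ 1`
  have h1 := Chebyshev.eventually_primeCounting_le one_pos
  set C : ℕ := A + B + 1 with hC
  have hCpos : (0 : ℝ) < C := by rw [hC]; positivity
  have hlog : ∀ᶠ x : ℝ in atTop, (Real.log 4 + 1) * C / ε ≤ Real.log x :=
    Real.tendsto_log_atTop.eventually_ge_atTop _
  have htend : Tendsto (fun N : ℕ => ((C * N : ℕ) : ℝ)) atTop atTop :=
    tendsto_natCast_atTop_atTop.comp
      ((tendsto_id (α := ℕ)).const_mul_atTop' (by omega))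
  filter_upwards [htend.eventually h1, htend.eventually hlog, eventually_ge_atTop 1,
    htend.eventually (eventually_gt_atTop 1)] with N hN hN2 hN1 hN3
  rw [Nat.floor_natCast] at hN
  have hmono : Nat.primeCounting (A + B * N) ≤ Nat.primeCounting (C * N) :=
    Nat.monotone_primeCounting (by rw [hC]; nlinarith)
  have hlogpos : 0 < Real.log ((C * N : ℕ) : ℝ) := Real.log_pos hN3
  calc (Nat.primeCounting (A + B * N) : ℝ) ≤ Nat.primeCounting (C * N) := by exact_mod_cast hmono
    _ ≤ (Real.log 4 + 1) * ((C * N : ℕ) : ℝ) / Real.log ((C * N : ℕ) : ℝ) := hN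
    _ ≤ ε * N := by
        rw [div_le_iff₀ hlogpos]
        rw [div_le_iff₀ hε] at hN2
        push_cast at hN2 ⊢
        have hN0 : (0 : ℝ) ≤ N := by positivity
        nlinarith

/-- In the progression `c + 3p² n`, for each prime `q ∤ 3p` the indices `n` of the values of `Δ`
divisible by `q²` occupy at most two residue classes modulo `q²`. -/
theorem card_filter_sq_dvd_le {p q : ℕ} (hp : p.Prime) (hq : q.Prime) (hq3 : q ≠ 3) (hqp : q ≠ p)
    (c : ℤ) (N : ℕ) :
    (((Finset.range N).filter fun n : ℕ =>
      (q : ℤ) ^ 2 ∣ simplestCubicDelta (c + 3 * p ^ 2 * n)).card : ℝ) ≤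
      2 * (N / (q ^ 2 : ℕ) + 1) := by
  have hcop : IsCoprime ((q : ℤ) ^ 2) (3 * p ^ 2) := by
    have : Nat.Coprime (q ^ 2) (3 * p ^ 2) := Nat.Coprime.pow_left 2
      (Nat.Coprime.mul_right ((Nat.coprime_primes hq Nat.prime_three).2 hq3)
        (Nat.Coprime.pow_right 2 ((Nat.coprime_primes hq hp).2 hqp)))
    exact_mod_cast Nat.isCoprime_iff_coprime.2 this
  have hmod : ∀ x y : ℕ, (q : ℤ) ^ 2 ∣ (3 * p ^ 2) * ((x : ℤ) - y) → x ≡ y [MOD q ^ 2] := by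
    intro x y hd
    have := hcop.dvd_of_dvd_mul_left hd
    refine (Nat.modEq_iff_dvd.2 ?_).symm
    exact_mod_cast this
  refine Finset.card_le_of_modEq_or (pow_pos hq.pos 2) (Finset.filter_subset _ _) ?_
  intro x hx y hy z hz
  have hx := (Finset.mem_filter.1 hx).2
  have hy := (Finset.mem_filter.1 hy).2
  have hz := (Finset.mem_filter.1 hz).2
  rcases pow_dvd_sub_or_pow_dvd_add hq hq3 hx hy with h1 | h1
  · exact Or.inl (hmod _ _ (by convert h1 using 1; ring))
  rcases pow_dvd_sub_or_pow_dvd_add hq hq3 hx hz with h2 | h2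
  · exact Or.inr (Or.inl (hmod _ _ (by convert h2 using 1; ring)))
  · exact Or.inr (Or.inr (hmod _ _ (by convert Int.dvd_sub h1 h2 using 1; ring)))

theorem card_filter_pow_three_dvd_le {p : ℕ} (hp : p.Prime) (hp3 : p ≠ 3) (c : ℤ) (N : ℕ) :
    (((Finset.range N).filter fun n : ℕ =>
      (p : ℤ) ^ 3 ∣ simplestCubicDelta (c + 3 * p ^ 2 * n)).card : ℝ) ≤ N / p + 1 := by
  have hpZ := Nat.prime_iff_prime_int.1 hp
  have hcop : IsCoprime (p : ℤ) 3 := by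
    exact_mod_cast Nat.isCoprime_iff_coprime.2 ((Nat.coprime_primes hp Nat.prime_three).2 hp3)
  refine Finset.card_le_of_modEq hp.pos (Finset.filter_subset _ _) ?_
  intro x hx y hy
  have hx := (Finset.mem_filter.1 hx).2
  have hy := (Finset.mem_filter.1 hy).2
  rcases pow_dvd_sub_or_pow_dvd_add hp hp3 hx hy with h1 | h1
  · have h2 : (p : ℤ) ^ 2 * p ∣ p ^ 2 * (3 * ((x : ℤ) - y)) := by
      convert h1 using 1 <;> ring
    have h3 := hcop.dvd_of_dvd_mul_left
      ((mul_dvd_mul_iff_left (pow_ne_zero 2 hpZ.ne_zero)).1 h2)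
    exact (Nat.modEq_iff_dvd.2 h3).symm
  · -- the arguments at `x` and `y` agree modulo `p`, where `Δ` has only simple roots
    exfalso
    refine hp.not_dvd_two_mul_add_three hp3 ((dvd_pow_self _ three_ne_zero).trans hx) ?_
    have h2 : (p : ℤ) ∣ p * (3 * p * ((x : ℤ) - y)) := dvd_mul_right _ _
    convert Int.dvd_add ((dvd_pow_self _ three_ne_zero).trans h1) h2 using 1
    ring

/-- A sieve for square-free values of the quadratic polynomial `Δ` in the progression `c + 3p² n`:
primes `q` up to `√Δ`, hence up to a linear bound in `N`, remove at most `2 (N / q² + 1)` of the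
first `N` terms; since `2 ∑_{q ≥ 5} 1 / q² + 1 / p < 1` and the number of primes up to a linear
bound is `o(N)`, some term survives. -/
theorem exists_simplestCubicDelta_progression {p : ℕ} (hp : p.Prime) (hp3 : 3 < p) (c : ℕ) :
    ∃ n : ℕ, ¬ (p : ℤ) ^ 3 ∣ simplestCubicDelta (c + 3 * p ^ 2 * n) ∧
      ∀ q : ℕ, q.Prime → q ≠ 3 → q ≠ p →
        ¬ (q : ℤ) ^ 2 ∣ simplestCubicDelta (c + 3 * p ^ 2 * n) := by
  by_contra! hbad
  obtain ⟨N, hN, hN6⟩ := ((eventually_primeCounting_le_mul (c + 3) (3 * p ^ 2)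
    (show (0 : ℝ) < 1 / 20 by norm_num)).and (Filter.eventually_ge_atTop 6)).exists
  set X := c + 3 + 3 * p ^ 2 * N with hX
  set Q := (Nat.primesLE X).filter fun q => q ≠ 2 ∧ q ≠ 3 ∧ q ≠ p with hQ
  set Sp := (Finset.range N).filter fun n : ℕ =>
    (p : ℤ) ^ 3 ∣ simplestCubicDelta (c + 3 * p ^ 2 * n) with hSp
  let S : ℕ → Finset ℕ := fun q => (Finset.range N).filter fun n : ℕ =>
    (q : ℤ) ^ 2 ∣ simplestCubicDelta (c + 3 * p ^ 2 * n)
  have hQmem : ∀ q ∈ Q, q.Prime ∧ q ≤ X ∧ q ≠ 2 ∧ q ≠ 3 ∧ q ≠ p := by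
    intro q hq
    obtain ⟨h1, h2⟩ := Finset.mem_filter.1 hq
    exact ⟨(Nat.mem_primesLE.1 h1).2, (Nat.mem_primesLE.1 h1).1, h2⟩
  have hcover : Finset.range N ⊆ Sp ∪ Q.biUnion S := by
    intro n hn
    by_cases h3 : (p : ℤ) ^ 3 ∣ simplestCubicDelta (c + 3 * p ^ 2 * n)
    · exact Finset.mem_union_left _ (Finset.mem_filter.2 ⟨hn, h3⟩)
    obtain ⟨q, hq, hq3, hqp, hdvd⟩ := hbad n h3
    have hq2 : q ≠ 2 := by
      rintro rfl
      exact not_two_dvd_simplestCubicDelta _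
        ((dvd_pow_self ((2 : ℕ) : ℤ) two_ne_zero).trans hdvd)
    refine Finset.mem_union_right _ (Finset.mem_biUnion.2
      ⟨q, Finset.mem_filter.2 ⟨Nat.mem_primesLE.2 ⟨?_, hq⟩, hq2, hq3, hqp⟩,
        Finset.mem_filter.2 ⟨hn, hdvd⟩⟩)
    have hle := Int.le_of_dvd (simplestCubicDelta_pos _) hdvd
    have hnN : n ≤ N := (Finset.mem_range.1 hn).le
    have h4 : c + 3 + 3 * p ^ 2 * n ≤ X := by rw [hX]; gcongr
    refine le_trans ?_ h4
    have hnn : (0 : ℤ) ≤ c + 3 * p ^ 2 * n := by positivity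
    have h5 : (q : ℤ) ^ 2 ≤ (c + 3 + 3 * p ^ 2 * n) ^ 2 := by
      refine hle.trans ?_
      unfold simplestCubicDelta
      nlinarith
    have h6 : (q : ℤ) ≤ c + 3 + 3 * p ^ 2 * n := le_of_sq_le_sq h5 (by linarith)
    exact_mod_cast h6
  have hcard : (N : ℝ) ≤ Sp.card + ∑ q ∈ Q, ((S q).card : ℝ) := by
    have h1 : N ≤ Sp.card + ∑ q ∈ Q, (S q).card := by
      calc N = (Finset.range N).card := (Finset.card_range N).symm
        _ ≤ _ := Finset.card_le_card hcover
        _ ≤ _ := Finset.card_union_le _ _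
        _ ≤ _ := by gcongr; exact Finset.card_biUnion_le
    exact_mod_cast h1
  have hSpcard : (Sp.card : ℝ) ≤ N / 5 + 1 := by
    refine (card_filter_pow_three_dvd_le hp hp3.ne' c N).trans ?_
    have : 5 ≤ p := by
      by_contra hlt
      have : p = 4 := by omega
      subst this
      exact absurd hp (by norm_num)
    have : (5 : ℝ) ≤ p := by exact_mod_cast this
    gcongr
  have hsum : ∑ q ∈ Q, ((S q).card : ℝ) ≤
      2 * N * ∑ q ∈ Q, ((q : ℝ) ^ 2)⁻¹ + 2 * Q.card := by
    calc ∑ q ∈ Q, ((S q).card : ℝ) ≤ ∑ q ∈ Q, (2 * N * ((q : ℝ) ^ 2)⁻¹ + 2) := by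
          refine Finset.sum_le_sum fun q hq => ?_
          obtain ⟨h1, -, -, h3, h4⟩ := hQmem q hq
          refine (card_filter_sq_dvd_le hp h1 h3 h4 c N).trans (le_of_eq ?_)
          push_cast
          ring
      _ = _ := by
          rw [Finset.sum_add_distrib, ← Finset.mul_sum, Finset.sum_const, nsmul_eq_mul]
          ring
  have hinv : ∑ q ∈ Q, ((q : ℝ) ^ 2)⁻¹ ≤ 1 / 4 := by
    have hsub : Q ⊆ Finset.Ioc 4 (X + 4) := by
      intro q hq
      obtain ⟨h1, h2, h3, h4, -⟩ := hQmem q hq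
      have := h1.two_le
      have h5 : q ≠ 4 := by rintro rfl; exact absurd h1 (by norm_num)
      exact Finset.mem_Ioc.2 ⟨by omega, by omega⟩
    calc ∑ q ∈ Q, ((q : ℝ) ^ 2)⁻¹ ≤ ∑ q ∈ Finset.Ioc 4 (X + 4), ((q : ℝ) ^ 2)⁻¹ :=
          Finset.sum_le_sum_of_subset_of_nonneg hsub fun _ _ _ => by positivity
      _ ≤ ((4 : ℕ) : ℝ)⁻¹ - ((X + 4 : ℕ) : ℝ)⁻¹ := sum_Ioc_inv_sq_le_sub (by norm_num) (by omega)
      _ ≤ 1 / 4 := by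
          have : (0 : ℝ) ≤ ((X + 4 : ℕ) : ℝ)⁻¹ := by positivity
          norm_num at this ⊢
          linarith
  have hQcard : (Q.card : ℝ) ≤ 1 / 20 * N := by
    refine le_trans ?_ hN
    have : Q.card ≤ (Nat.primesLE X).card := Finset.card_filter_le _ _
    rw [Nat.primesLE_card_eq_primeCounting] at this
    exact_mod_cast this
  have hN6' : (6 : ℝ) ≤ N := by exact_mod_cast hN6
  nlinarith

/-- Each root of `Δ` modulo `p²` is the class of some `a ≥ -1` satisfying the conditions for
index `p`. -/
theorem exists_simplestCubicDelta {p : ℕ} (hp : p.Prime) (hp3 : 3 < p) {c : ℤ}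
    (hc : (p : ℤ) ^ 2 ∣ simplestCubicDelta c) :
    ∃ a : ℤ, -1 ≤ a ∧ (p : ℤ) ^ 2 ∣ a - c ∧ (p : ℤ) ^ 2 ∣ simplestCubicDelta a ∧
      ¬ (p : ℤ) ^ 3 ∣ simplestCubicDelta a ∧
      (∀ q : ℕ, q.Prime → q ≠ 3 → q ≠ p → ¬ (q : ℤ) ^ 2 ∣ simplestCubicDelta a) ∧
      a % 9 ≠ 3 := by
  -- a starting value `c₀ ≥ 0` with `c₀ ≡ c (mod p²)` and `c₀ ≡ 1 (mod 3)`
  obtain ⟨c₀, hc₀, hc₀3⟩ : ∃ c₀ : ℕ, (p : ℤ) ^ 2 ∣ c₀ - c ∧ ¬ (3 : ℤ) ∣ c₀ := by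
    have hcop : IsCoprime ((p : ℤ) ^ 2) 3 := by
      have : Nat.Coprime (p ^ 2) 3 :=
        Nat.Coprime.pow_left 2 ((Nat.coprime_primes hp Nat.prime_three).2 hp3.ne')
      exact_mod_cast Nat.isCoprime_iff_coprime.2 this
    obtain ⟨u, v, huv⟩ := hcop
    set c' : ℤ := c + p ^ 2 * (u * (1 - c)) with hc'
    have hpos : 0 ≤ c' + 3 * p ^ 2 * |c'| := by
      have h1 : (1 : ℤ) ≤ p ^ 2 := by exact_mod_cast Nat.one_le_pow _ _ hp.pos
      have h2 := neg_abs_le c'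
      nlinarith [abs_nonneg c']
    refine ⟨(c' + 3 * p ^ 2 * |c'|).toNat, ?_, ?_⟩
    · rw [Int.toNat_of_nonneg hpos]
      exact ⟨u * (1 - c) + 3 * |c'|, by rw [hc']; ring⟩
    · rw [Int.toNat_of_nonneg hpos]
      rintro ⟨x, hx⟩
      have : 3 * (x - p ^ 2 * |c'| + v * (1 - c)) = 1 := by
        linear_combination -hx + (1 - c) * huv + hc'
      omega
  obtain ⟨n, hn3, hnq⟩ := exists_simplestCubicDelta_progression hp hp3 c₀
  have hdiff : (p : ℤ) ^ 2 ∣ c₀ + 3 * p ^ 2 * n - c := by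
    obtain ⟨x, hx⟩ := hc₀
    exact ⟨x + 3 * n, by linear_combination hx⟩
  refine ⟨c₀ + 3 * p ^ 2 * n, ?_, hdiff, ?_, hn3, hnq, ?_⟩
  · have : (0 : ℤ) ≤ c₀ + 3 * p ^ 2 * n := by positivity
    linarith
  · set b : ℤ := c₀ + 3 * p ^ 2 * n
    have e : simplestCubicDelta b = simplestCubicDelta c + (b - c) * (b + c + 3) := by
      unfold simplestCubicDelta; ring
    rw [e]
    exact Int.dvd_add hc (hdiff.mul_right _)
  · intro h9
    apply hc₀3
    have : (3 : ℤ) ∣ c₀ + 3 * (p ^ 2 * n) := by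
      rw [← mul_assoc]; omega
    omega

/-! ### Roots of `Δ` modulo `p²` -/

/-- A root of `Δ` modulo `p` is `3` times a primitive cube root of unity. -/
theorem mod_six_of_prime_dvd_simplestCubicDelta {p : ℕ} (hp : p.Prime) (hp3 : 3 < p) {a : ℤ}
    (h : (p : ℤ) ∣ simplestCubicDelta a) : p ≡ 1 [MOD 6] := by
  have : Fact p.Prime := ⟨hp⟩
  have h3 : (3 : ZMod p) ≠ 0 := by
    intro h0
    have : ((3 : ℕ) : ZMod p) = 0 := by exact_mod_cast h0
    rw [ZMod.natCast_eq_zero_iff] at this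
    exact absurd (Nat.le_of_dvd (by norm_num) this) (by omega)
  -- `x = a / 3` satisfies `x² + x + 1 = 0`, so it has order `3`
  have hΔ : (a : ZMod p) ^ 2 + 3 * a + 9 = 0 := by
    have := (ZMod.intCast_zmod_eq_zero_iff_dvd _ p).2 h
    unfold simplestCubicDelta at this
    exact_mod_cast this
  set x : ZMod p := a / 3 with hx
  have hax : (a : ZMod p) = 3 * x := by rw [hx]; field_simp
  have hxx : x ^ 2 + x + 1 = 0 := by
    rw [hax] at hΔ
    have : (3 : ZMod p) ^ 2 * (x ^ 2 + x + 1) = 0 := by linear_combination hΔ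
    exact (mul_eq_zero.1 this).resolve_left (pow_ne_zero 2 h3)
  have hx3 : x ^ 3 = 1 := by linear_combination (x - 1) * hxx
  have hx1 : x ≠ 1 := by
    intro h1
    rw [h1] at hxx
    exact h3 (by linear_combination hxx)
  have hx0 : x ≠ 0 := by rintro h0; rw [h0] at hxx; simp at hxx
  have hord : orderOf x = 3 := orderOf_eq_prime hx3 hx1
  have hdvd : 3 ∣ p - 1 := hord ▸ ZMod.orderOf_dvd_card_sub_one hx0
  have hodd := hp.eq_two_or_odd
  unfold Nat.ModEq
  omega

/-- If `u` has order `3` in the units modulo `p²`, then `3u` is a root of `Δ` modulo `p²`. -/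
theorem exists_sq_dvd_simplestCubicDelta {p : ℕ} (hp : p.Prime) (h : p ≡ 1 [MOD 6]) :
    ∃ c : ℤ, (p : ℤ) ^ 2 ∣ simplestCubicDelta c := by
  have : Fact p.Prime := ⟨hp⟩
  have : NeZero (p ^ 2) := ⟨pow_ne_zero 2 hp.ne_zero⟩
  have hcard : 3 ∣ Fintype.card (ZMod (p ^ 2))ˣ := by
    rw [ZMod.card_units_eq_totient, Nat.totient_prime_pow hp two_pos]
    refine Dvd.dvd.mul_left ?_ _
    unfold Nat.ModEq at h
    omega
  obtain ⟨u, hu⟩ := exists_prime_orderOf_dvd_card 3 hcard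
  obtain ⟨n, hn⟩ := ZMod.intCast_surjective (u : ZMod (p ^ 2))
  have hn3 : ((p ^ 2 : ℕ) : ℤ) ∣ n ^ 3 - 1 := by
    rw [← ZMod.intCast_zmod_eq_zero_iff_dvd]
    push_cast
    rw [hn, ← Units.val_pow_eq_pow_val, ← hu, pow_orderOf_eq_one]
    simp
  have hn1 : ¬ ((p ^ 2 : ℕ) : ℤ) ∣ n - 1 := by
    rw [← ZMod.intCast_zmod_eq_zero_iff_dvd]
    push_cast
    rw [hn, sub_eq_zero]
    intro h1
    rw [Units.val_eq_one] at h1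
    rw [h1, orderOf_one] at hu
    norm_num at hu
  push_cast at hn3 hn1
  have hpZ := Nat.prime_iff_prime_int.1 hp
  have hmul : (p : ℤ) ^ 2 ∣ (n - 1) * (n ^ 2 + n + 1) := by
    convert hn3 using 1; ring
  have hp3 : p ≠ 3 := by rintro rfl; revert h; decide
  refine ⟨3 * n, ?_⟩
  have e : simplestCubicDelta (3 * n) = 9 * (n ^ 2 + n + 1) := by unfold simplestCubicDelta; ring
  rw [e]
  refine Dvd.dvd.mul_left ?_ _
  by_cases hd : (p : ℤ) ∣ n - 1
  · -- then `n² + n + 1 ≡ 3` is a unit modulo `p`, which forces `n ≡ 1 (mod p²)`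
    exfalso
    have hnd : ¬ (p : ℤ) ∣ n ^ 2 + n + 1 := by
      intro hd'
      have h3 : (p : ℤ) ∣ 3 := by
        have e3 : (3 : ℤ) = (n ^ 2 + n + 1) - (n - 1) * (n + 2) := by ring
        rw [e3]
        exact Int.dvd_sub hd' (hd.mul_right _)
      exact hp3 ((Nat.prime_dvd_prime_iff_eq hp Nat.prime_three).1 (by exact_mod_cast h3))
    exact hn1 (natPrime_sq_dvd_of_sq_dvd_mul hp hnd hmul)
  · exact ((hpZ.coprime_iff_not_dvd.2 hd).pow_left).dvd_of_dvd_mul_left hmul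

/-! ### Residue classes of parameters with a given prime index -/

theorem simplestCubicDelta_neg_three_sub (c : ℤ) :
    simplestCubicDelta (-3 - c) = simplestCubicDelta c := by
  unfold simplestCubicDelta; ring

theorem exists_isSimplestCubicField_moduleIndex_eq {p : ℕ} (hp : p.Prime) (hp3 : 3 < p) {c : ℤ}
    (hc : (p : ℤ) ^ 2 ∣ simplestCubicDelta c) :
    ∃ (K : Type u) (_ : Field K) (_ : NumberField K) (a : ℤ) (ρ : K),
      IsSimplestCubicField K a ρ ∧ moduleIndex ρ = p ∧ (a : ZMod (p ^ 2)) = c := by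
  obtain ⟨a, ha, hac, h1, h2, h3, h4⟩ := exists_simplestCubicDelta hp hp3 hc
  obtain ⟨K, i1, i2, ρ, h⟩ := exists_isSimplestCubicField.{u} ha
  refine ⟨K, i1, i2, a, ρ, h, (h.moduleIndex_eq_prime_iff hp hp3).2 ⟨h1, h2, h3, h4⟩, ?_⟩
  rw [← sub_eq_zero, ← Int.cast_sub, ZMod.intCast_zmod_eq_zero_iff_dvd]
  exact_mod_cast hac

theorem mainTheorem1 :
    -- Part 1
    (∀ (K : Type u) [Field K] [NumberField K] (a : ℤ) (ρ : K), IsSimplestCubicField K a ρ →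
      (moduleIndex ρ = 3 ↔ IsIntegralBasis (basisB ρ 3 1 1)) ∧
      (moduleIndex ρ = 3 ↔
        a = 3 ∨ ((a ≡ 3 [ZMOD 27] ∨ a ≡ 21 [ZMOD 27]) ∧ 12 < a ∧
          Squarefree (simplestCubicDelta a / 27)))) ∧
    -- Part 2
    (∀ p : ℕ, p.Prime → 3 < p →
      (∀ (K : Type u) [Field K] [NumberField K] (a : ℤ) (ρ : K), IsSimplestCubicField K a ρ →
        (moduleIndex ρ = p ↔
          ∃ k l : ℤ, 1 ≤ k ∧ k ≤ p - 1 ∧ 1 ≤ l ∧ l ≤ p - 1 ∧ IsIntegralBasis (basisB ρ p k l))) ∧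
      ((∃ (K : Type u) (_ : Field K) (_ : NumberField K) (a : ℤ) (ρ : K),
        IsSimplestCubicField K a ρ ∧ moduleIndex ρ = p) ↔ p ≡ 1 [MOD 6]) ∧
      (p ≡ 1 [MOD 6] → ∃ a₁ a₂ : ZMod (p ^ 2), a₁ ≠ a₂ ∧
        -- the classes of `a` that occur are exactly `a₁` and `a₂`
        (∀ α : ZMod (p ^ 2),
          (∃ (K : Type u) (_ : Field K) (_ : NumberField K) (a : ℤ) (ρ : K),
            IsSimplestCubicField K a ρ ∧ moduleIndex ρ = p ∧ (a : ZMod (p ^ 2)) = α) ↔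
          α = a₁ ∨ α = a₂) ∧
        -- each of the two classes determines `k` and `l` modulo `p`
        (∀ α : ZMod (p ^ 2), α = a₁ ∨ α = a₂ →
          ∃! κ : ZMod p × ZMod p,
            ∀ (K : Type u) [Field K] [NumberField K] (a : ℤ) (ρ : K),
              IsSimplestCubicField K a ρ → (a : ZMod (p ^ 2)) = α →
              ∀ k l : ℤ, IsIntegralBasis (basisB ρ p k l) →
                (k : ZMod p) = κ.1 ∧ (l : ZMod p) = κ.2))) := by
  refine ⟨fun K _ _ a ρ h => ⟨h.moduleIndex_eq_three_iff_isIntegralBasis,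
    h.moduleIndex_eq_three_iff.trans (index_three_condition_iff h.neg_one_le)⟩,
    fun p hp hp3 => ⟨fun K _ _ a ρ h => h.moduleIndex_eq_prime_iff_isIntegralBasis hp hp3,
      ⟨?_, ?_⟩, fun hp6 => ?_⟩⟩
  · rintro ⟨K, _, _, a, ρ, h, hδ⟩
    exact mod_six_of_prime_dvd_simplestCubicDelta hp hp3
      ((dvd_pow_self _ two_ne_zero).trans (h.of_moduleIndex_eq_prime hp hp3.ne' hδ).1)
  · intro hp6
    obtain ⟨c, hc⟩ := exists_sq_dvd_simplestCubicDelta hp hp6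
    obtain ⟨K, i1, i2, a, ρ, h, hδ, -⟩ :=
      exists_isSimplestCubicField_moduleIndex_eq.{u} hp hp3 hc
    exact ⟨K, i1, i2, a, ρ, h, hδ⟩
  · obtain ⟨c, hc⟩ := exists_sq_dvd_simplestCubicDelta hp hp6
    have hc' : (p : ℤ) ^ 2 ∣ simplestCubicDelta (-3 - c) := by
      rwa [simplestCubicDelta_neg_three_sub]
    have hcast : ∀ x y : ℤ, (x : ZMod (p ^ 2)) = y ↔ (p : ℤ) ^ 2 ∣ x - y := by
      intro x y
      rw [← sub_eq_zero, ← Int.cast_sub, ZMod.intCast_zmod_eq_zero_iff_dvd]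
      push_cast
      exact Iff.rfl
    have hlift : ∀ α : ZMod (p ^ 2), α = (c : ZMod (p ^ 2)) ∨ α = ((-3 - c : ℤ) : ZMod (p ^ 2)) →
        ∃ b : ℤ, (p : ℤ) ^ 2 ∣ simplestCubicDelta b ∧ (b : ZMod (p ^ 2)) = α := by
      rintro α (rfl | rfl)
      · exact ⟨c, hc, rfl⟩
      · exact ⟨-3 - c, hc', rfl⟩
    refine ⟨c, (-3 - c : ℤ), ?_, fun α => ⟨?_, fun hα => ?_⟩, fun α hα => ?_⟩
    · rw [Ne, hcast]
      intro hdvd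
      refine hp.not_dvd_two_mul_add_three hp3.ne' ((dvd_pow_self _ two_ne_zero).trans hc) ?_
      have e : 2 * c + 3 = c - (-3 - c) := by ring
      rw [e]
      exact (dvd_pow_self (p : ℤ) two_ne_zero).trans hdvd
    · rintro ⟨K, _, _, a, ρ, h, hδ, rfl⟩
      rw [hcast, hcast]
      have hor : (p : ℤ) ^ 2 ∣ a - c ∨ (p : ℤ) ^ 2 ∣ a + c + 3 :=
        pow_dvd_sub_or_pow_dvd_add (n := 1) hp hp3.ne'
          (h.of_moduleIndex_eq_prime hp hp3.ne' hδ).1 hc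
      have e : a - (-3 - c) = a + c + 3 := by ring
      rwa [e]
    · obtain ⟨b, hb, rfl⟩ := hlift α hα
      exact exists_isSimplestCubicField_moduleIndex_eq hp hp3 hb
    · obtain ⟨b, hb, rfl⟩ := hlift α hα
      have : Fact p.Prime := ⟨hp⟩
      have h9 : (9 : ZMod p) ≠ 0 := by
        intro h0
        have hunit := hp.isCoprime_int_nine hp3.ne'
        obtain ⟨u, v, huv⟩ := hunit
        have := congrArg (Int.cast : ℤ → ZMod p) huv
        push_cast at this
        rw [h0, CharP.cast_eq_zero] at this
        simp at this
      have hdet : ∀ (K : Type u) [Field K] [NumberField K] (a : ℤ) (ρ : K),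
          IsSimplestCubicField K a ρ → (a : ZMod (p ^ 2)) = b →
          ∀ k l : ℤ, IsIntegralBasis (basisB ρ p k l) →
            (k : ZMod p) = (b : ZMod p) ^ 2 / 9 ∧ (l : ZMod p) = -6 * (b : ZMod p) / 9 := by
        intro K _ _ a ρ h hab k l hB
        have hdvd := (hcast a b).1 hab
        have hΔ : (p : ℤ) ^ 2 ∣ simplestCubicDelta a := by
          have e : simplestCubicDelta a = simplestCubicDelta b + (a - b) * (a + b + 3) := by
            unfold simplestCubicDelta; ring
          rw [e]
          exact Int.dvd_add hb (hdvd.mul_right _)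
        have habp : (a : ZMod p) = b := by
          rw [← sub_eq_zero, ← Int.cast_sub, ZMod.intCast_zmod_eq_zero_iff_dvd]
          exact (dvd_pow_self _ two_ne_zero).trans hdvd
        obtain ⟨h1, h2⟩ := h.nine_mul_eq_of_isIntegralBasis hp.ne_zero hΔ hB
        rw [habp] at h1 h2
        exact ⟨by rw [← h1]; field_simp, by rw [← h2]; field_simp⟩
      refine ⟨((b : ZMod p) ^ 2 / 9, -6 * (b : ZMod p) / 9), hdet, fun κ hκ => ?_⟩
      -- a field of index `p` in the class shows that the pair is determined
      obtain ⟨K, _, _, a, ρ, h, hδ, hab⟩ :=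
        exists_isSimplestCubicField_moduleIndex_eq.{u} hp hp3 hb
      obtain ⟨k, l, -, -, -, -, hB⟩ := (h.moduleIndex_eq_prime_iff_isIntegralBasis hp hp3).1 hδ
      obtain ⟨h1, h2⟩ := hdet K a ρ h hab k l hB
      obtain ⟨h3, h4⟩ := hκ K a ρ h hab k l hB
      exact Prod.ext (h3.symm.trans h1) (h4.symm.trans h2)
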